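/- **Setting.** Let $S^1=\mathbb R/\mathbb Z$ with Haar probability measure $m$, and let $R_r(\theta)=\theta+r$. A nonempty proper subset $U\subset S^1$ is *regular open* if $\mathrm{Int}(\mathrm{Cl}\,U)=U$; put $U^*=\mathrm{Int}(S^1\setminus U)$. Let $\mathcal{RO}$ be the set of regular open sets with the metric $d_*(U,V)=\tfrac12\bigl(m(U\triangle V)+m(U^*\triangle V^*)\bigr)$, and $\mathcal{RO}_0=\{U\in\mathcal{RO}: m(\mathrm{Fr}\,U)=0\}$. Let $\mathcal{RO}'$ and $\mathcal{RO}_0'$ be the quotients by the relation $U\sim R_\eta(U)$, $\eta\in S^1$, with the quotient topology. Let $\Sigma_2=\{0,1\}^{\mathbb Z}$ with the shift $(\sigma s)_i=s_{i+1}$, let $\mathcal M(\Sigma_2,\sigma)$ be the set of $\sigma$-invariant Borel probability measures with the weak topology, and $\mathcal H(\Sigma_2)$ the set of closed subsets of $\Sigma_2$. For $U\in\mathcal{RO}$ and $r\in S^1$ let $B=\{x\in S^1: R_r^i(x)\notin \mathrm{Fr}\,U\ \forall i\in\mathbb Z\}$ and $\phi:B\to\Sigma_2$, $\phi(x)_i=\mathbf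 1_U(R_r^i(x))$. Put $\Lambda(U,r)=\mathrm{Cl}(\phi(B))$ and, if $U\in\mathcal{RO}_0$, $\lambda(U,r)=\phi_*(m)$. Both depend only on the class of $U$ modulo rotation, so they define maps $\Lambda:\mathcal{RO}'\times S^1\to\mathcal H(\Sigma_2)$ and $\lambda:\mathcal{RO}_0'\times S^1\to\mathcal M(\Sigma_2,\sigma)$. A set is *minimal* if it is nonempty, compact, invariant, and every orbit in it is dense in it. An extension is *almost one to one* if it is given by a continuous surjective semiconjugacy for which the points that are alone in their fibres contain a dense $G_\delta$. A *Denjoy minimal set with intrinsic rotation number $\rho$* is a system topologically conjugate to the minimal set of an orientation preserving, non-minimal circle homeomorphism with irrational rotation number $\rho$ (mod 1). **Theorem 2.** (1) $\lambda$ is continuous, and $\Lambda$ is lower semicontinuous, i.e. $\{e\in\mathcal{RO}'\times S^1:\Lambda(e)\subset Y\}$ is closed for every closed $Y\subset\Sigma_2$. (2) Fix $\alpha\notin\mathbb Q$. (a) For every $U\in\mathcal{RO}'$, $(\Lambda(U,\alpha),\sigma)$ is minimal and is an almost one to one extension of $(S^1,R_{n\alpha})$ for some integer $n\ge 1$. (b)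 If $U\in\mathcal{RO}_0'$, then $(\Lambda(U,\alpha),\sigma)$ is uniquely ergodic. (c) If $\mathrm{Fr}\,U$ is finite, then $(\Lambda(U,\alpha),\sigma)$ is a Denjoy minimal set with intrinsic rotation number $n\alpha$ for some integer $n\ge1$. (d) The maps $U\mapsto\Lambda(U,\alpha)$ on $\mathcal{RO}'$ and $U\mapsto\lambda(U,\alpha)$ on $\mathcal{RO}_0'$ are injective. (3) Fix $p/q\in\mathbb Q$ with $p\in\mathbb Z$ and $q\ge1$ relatively prime. (a) For every $U\in\mathcal{RO}'$, $\Lambda(U,p/q)$ is a finite nonempty union of periodic orbits of $\sigma$ whose periods divide $q$. (b) The image of $U\mapsto\lambda(U,p/q)$, $U\in\mathcal{RO}_0'$, is the convex hull of the invariant probability measures supported on single periodic orbits of $\sigma$ whose periods divide $q$, with exactly two points removed: the point masses at the constant sequences $\dots000\dots$ and $\dots111\dots$ (which would correspond to the excluded sets $U=\emptyset$ and $U=S^1$). -/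

import Mathlib

open MeasureTheory Topology

noncomputable section

namespace DenjoyDisks

/-! ### Dynamical systems -/

section Dynamics

variable {X Z : Type*} [TopologicalSpace X] [TopologicalSpace Z]

/-- The full (two-sided) orbit of `x` under the homeomorphism `h`. -/
def orbit (h : X ≃ₜ X) (x : X) : Set X := Set.range fun n : ℤ => (h ^ n) x

/-- `Y` is a minimal set of `h`: a nonempty compact invariant set in which every orbit is dense. -/
structure IsMinimalSet (h : X ≃ₜ X) (Y : Set X) : Prop where
  isCompact : IsCompact Y
  nonempty : Y.Nonempty
  invariant : h '' Y = Y
  dense_orbit : ∀ x ∈ Y, Y ⊆ closure (orbit h x)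

/-- `(Y, h)` is an almost one to one extension of `(Z, g)`: there is a continuous surjective
semiconjugacy `ψ : Y → Z`, and the points of `Y` that are alone in their `ψ`-fibre contain a
dense `Gδ` subset of `Y`. -/
def IsAlmostOneToOneExtension (h : X ≃ₜ X) (Y : Set X) (g : Z ≃ₜ Z) : Prop :=
  h '' Y = Y ∧ ∃ ψ : Y → Z, Continuous ψ ∧ Function.Surjective ψ ∧
    (∀ (x : Y) (hx : h x ∈ Y), ψ ⟨h x, hx⟩ = g (ψ x)) ∧
    ∃ D : Set Y, IsGδ D ∧ Dense D ∧ ∀ x ∈ D, ∀ y : Y, ψ y = ψ x → y = x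

/-- The invariant sets `(Y, h)` and `(K, g)` are topologically conjugate. -/
def AreConjugate (h : X ≃ₜ X) (Y : Set X) (g : Z ≃ₜ Z) (K : Set Z) : Prop :=
  h '' Y = Y ∧ g '' K = K ∧
    ∃ e : Y ≃ₜ K, ∀ (x : Y) (hx : h x ∈ Y), (e ⟨h x, hx⟩ : Z) = g (e x)

/-- The space of `h`-invariant Borel probability measures, with the weak topology
(inherited from `ProbabilityMeasure X`). -/
abbrev InvMeasure [MeasurableSpace X] (h : X ≃ₜ X) : Type _ :=
  {μ : ProbabilityMeasure X // MeasurePreserving h (μ : Measure X) (μ : Measure X)}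

/-- `(Y, h)` carries exactly one invariant Borel probability measure. -/
def IsUniquelyErgodic [MeasurableSpace X] (h : X ≃ₜ X) (Y : Set X) : Prop :=
  ∃! μ : InvMeasure h, (μ.1 : Measure X) Yᶜ = 0

/-- The convex hull of a set of invariant probability measures, taken in the real vector space
of finite signed measures. -/
def measureHull [MeasurableSpace X] {h : X ≃ₜ X} (S : Set (InvMeasure h)) : Set (InvMeasure h) :=
  {μ | (μ.1 : Measure X).toSignedMeasure ∈
    convexHull ℝ ((fun ν : InvMeasure h => (ν.1 : Measure X).toSignedMeasure) '' S)}

/-- `s` is a periodic point of `h` whose (least) period divides `q`. -/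
def IsPeriodicDividing (h : X ≃ₜ X) (q : ℕ) (s : X) : Prop :=
  s ∈ Function.periodicPts h ∧ Function.minimalPeriod h s ∣ q

/-- The invariant probability measures supported on a single periodic orbit whose period
divides `q`. -/
def periodicOrbitMeasures [MeasurableSpace X] (h : X ≃ₜ X) (q : ℕ) : Set (InvMeasure h) :=
  {μ | ∃ s : X, IsPeriodicDividing h q s ∧ (μ.1 : Measure X) (orbit h s)ᶜ = 0}

/-- Lower semicontinuity of a map into the closed subsets of `Z`: for every closed `Y ⊆ Z`, the
set of points whose image is contained in `Y` is closed. -/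
def IsLowerSemicontinuous (Φ : X → TopologicalSpace.Closeds Z) : Prop :=
  ∀ Y : Set Z, IsClosed Y → IsClosed {e : X | (Φ e : Set Z) ⊆ Y}

end Dynamics

/-! ### The circle -/

/-- The circle `ℝ/ℤ`. -/
abbrev S1 : Type := AddCircle (1 : ℝ)

/-- Haar probability measure on the circle. -/
abbrev m : Measure S1 := AddCircle.haarAddCircle

/-- The rigid rotation `θ ↦ θ + r`. -/
def rot (r : S1) : S1 ≃ₜ S1 := Homeomorph.addRight r

/-- `g` is a Denjoy example with rotation number `ρ` (mod 1): an orientation preserving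
homeomorphism of the circle (one with a continuous monotone lift of degree one) whose rotation
number is irrational and which is not minimal. -/
def IsDenjoyExample (g : S1 ≃ₜ S1) (ρ : S1) : Prop :=
  (∃ f : CircleDeg1Lift, Continuous f ∧ (∀ x : ℝ, ((f x : ℝ) : S1) = g (x : S1)) ∧
    Irrational f.translationNumber ∧ ((f.translationNumber : ℝ) : S1) = ρ) ∧
  ¬ IsMinimalSet g Set.univ

/-- `(Y, h)` is a Denjoy minimal set with intrinsic rotation number `ρ`: it is topologically
conjugate to the minimal set of a Denjoy example with rotation number `ρ`. -/
def IsDenjoyMinimalSet {X : Type*} [TopologicalSpace X] (h : X ≃ₜ X) (Y : Set X) (ρ : S1) : Prop :=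
  ∃ (g : S1 ≃ₜ S1) (K : Set S1), IsDenjoyExample g ρ ∧ IsMinimalSet g K ∧ AreConjugate h Y g K

/-! ### Regular open sets -/

/-- Regular open sets of the circle: nonempty proper subsets `U` with `Int (Cl U) = U`. -/
@[ext]
structure RO where
  carrier : Set S1
  nonempty : carrier.Nonempty
  ne_univ : carrier ≠ Set.univ
  regular : interior (closure carrier) = carrier

/-- The dual `U* = Int (Uᶜ)`. -/
def dual (U : Set S1) : Set S1 := interior Uᶜ

lemma RO.isOpen (U : RO) : IsOpen U.carrier := U.regular ▸ isOpen_interior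

lemma RO.subset_of_null (U V : RO) (h : m (symmDiff U.carrier V.carrier) = 0) :
    U.carrier ⊆ V.carrier := by
  have ho : IsOpen (U.carrier \ closure V.carrier) := U.isOpen.sdiff isClosed_closure
  have h0 : m (U.carrier \ closure V.carrier) = 0 := by
    refine measure_mono_null ?_ h
    intro x hx
    exact Or.inl ⟨hx.1, fun hV => hx.2 (subset_closure hV)⟩
  have he : U.carrier \ closure V.carrier = ∅ := (ho.measure_eq_zero_iff m).1 h0
  rw [← V.regular]
  exact interior_maximal (Set.sdiff_eq_empty.1 he) U.isOpen

/-- The metric `d_*(U, V) = (m(U ∆ V) + m(U* ∆ V*)) / 2`. -/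
instance : MetricSpace RO where
  dist U V := (m.real (symmDiff U.carrier V.carrier) +
    m.real (symmDiff (dual U.carrier) (dual V.carrier))) / 2
  dist_self U := by simp
  dist_comm U V := by
    rw [symmDiff_comm U.carrier, symmDiff_comm (dual U.carrier)]
  dist_triangle U V W := by
    have h1 := measureReal_symmDiff_le (μ := m) (s := U.carrier) (t := V.carrier) W.carrier
    have h2 := measureReal_symmDiff_le (μ := m) (s := dual U.carrier) (t := dual V.carrier)
      (dual W.carrier)
    linarith
  eq_of_dist_eq_zero := by
    intro U V h
    have h1 : 0 ≤ m.real (symmDiff U.carrier V.carrier) := measureReal_nonneg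
    have h2 : 0 ≤ m.real (symmDiff (dual U.carrier) (dual V.carrier)) := measureReal_nonneg
    have h3 : m.real (symmDiff U.carrier V.carrier) = 0 := by linarith
    have h4 : m (symmDiff U.carrier V.carrier) = 0 := (measureReal_eq_zero_iff).1 h3
    refine RO.ext (Set.Subset.antisymm (RO.subset_of_null U V h4) (RO.subset_of_null V U ?_))
    rwa [symmDiff_comm]

/-- The rotated set `R_η(U)`. -/
def RO.rotate (η : S1) (U : RO) : RO where
  carrier := rot η '' U.carrier
  nonempty := U.nonempty.image _
  ne_univ h := U.ne_univ (by
    rw [← Set.preimage_image_eq U.carrier (rot η).injective, h, Set.preimage_univ])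
  regular := by
    rw [← (rot η).image_closure, ← (rot η).image_interior, U.regular]

/-- `U ∼ V` if `V = R_η(U)` for some `η`. -/
instance rotSetoid : Setoid RO where
  r U V := ∃ η : S1, V = U.rotate η
  iseqv :=
    { refl := fun U => ⟨0, by
        ext x
        simp [RO.rotate, rot]⟩
      symm := by
        rintro U V ⟨η, rfl⟩
        refine ⟨-η, ?_⟩
        ext x
        simp [RO.rotate, rot]
      trans := by
        rintro U V W ⟨η, rfl⟩ ⟨ξ, rfl⟩
        refine ⟨η + ξ, ?_⟩
        ext x
        simp [RO.rotate, rot, add_assoc] }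

/-- Regular open sets with null frontier. -/
abbrev RO0 : Type := {U : RO // m (frontier U.carrier) = 0}

/-- Rotation equivalence on `RO0`. -/
instance rotSetoid0 : Setoid RO0 := Setoid.comap Subtype.val rotSetoid

/-- Regular open sets modulo rotation, with the quotient topology. -/
abbrev RO' : Type := Quotient rotSetoid

/-- Regular open sets with null frontier modulo rotation, with the quotient topology. -/
abbrev RO0' : Type := Quotient rotSetoid0

/-! ### The two-shift and the main construction -/

/-- The sequence space `{0,1}^ℤ`. -/
abbrev Sigma2 : Type := ℤ → Fin 2

/-- The shift map `(σ s)_i = s_{i+1}`. -/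
def shift : Sigma2 ≃ₜ Sigma2 where
  toFun s i := s (i + 1)
  invFun s i := s (i - 1)
  left_inv s := by ext i; simp
  right_inv s := by ext i; simp
  continuous_toFun := by fun_prop
  continuous_invFun := by fun_prop

/-- The set `B = {x : o(x, R_r) ∩ Fr U = ∅}`. -/
def goodSet (U : RO) (r : S1) : Set S1 := {x | orbit (rot r) x ∩ frontier U.carrier = ∅}

open Classical in
/-- The itinerary `φ(x)_i = 1_U(R_r^i x)`; it is used only for `x` in `goodSet U r`. -/
def itinerary (U : RO) (r : S1) (x : S1) : Sigma2 := fun i =>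
  if (rot r ^ i) x ∈ U.carrier then 1 else 0

lemma rot_zpow (r : S1) (i : ℤ) (x : S1) : (rot r ^ i) x = x + i • r := by
  have hnat : ∀ (r : S1) (n : ℕ) (x : S1), (rot r ^ n) x = x + n • r := by
    intro r n
    induction n with
    | zero => intro x; simp
    | succ k ih =>
      intro x
      rw [pow_succ, Homeomorph.mul_apply, ih, succ_nsmul']
      simp [rot, add_assoc]
  have hinv : (rot r)⁻¹ = rot (-r) := by
    ext x
    rw [← (rot r).injective.eq_iff]
    change rot r ((rot r).symm x) = _
    rw [Homeomorph.apply_symm_apply]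
    simp [rot]
  cases i with
  | ofNat n => simpa using hnat r n x
  | negSucc n =>
    rw [zpow_negSucc, ← inv_pow, hinv, hnat, negSucc_zsmul, smul_neg]

lemma mem_goodSet {U : RO} {r x : S1} :
    x ∈ goodSet U r ↔ ∀ i : ℤ, x + i • r ∉ frontier U.carrier := by
  simp [goodSet, orbit, rot_zpow, Set.eq_empty_iff_forall_notMem]

lemma mem_goodSet_rotate {U : RO} {r x : S1} (η : S1) :
    x ∈ goodSet (U.rotate η) r ↔ x - η ∈ goodSet U r := by
  have h : frontier (U.rotate η).carrier = rot η '' frontier U.carrier :=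
    ((rot η).image_frontier _).symm
  simp only [mem_goodSet, h]
  refine forall_congr' fun i => not_congr ?_
  simp [rot, sub_eq_add_neg, add_right_comm]

open Classical in
lemma itinerary_apply (U : RO) (r x : S1) (i : ℤ) :
    itinerary U r x i = if x + i • r ∈ U.carrier then 1 else 0 := by
  unfold itinerary
  exact if_congr (by rw [rot_zpow]) rfl rfl

open Classical in
lemma itinerary_rotate (U : RO) (r x η : S1) :
    itinerary (U.rotate η) r x = itinerary U r (x - η) := by
  funext i
  rw [itinerary_apply, itinerary_apply]
  refine if_congr ?_ rfl rfl
  simp [RO.rotate, rot, sub_eq_add_neg, add_right_comm]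

open Classical in
lemma itinerary_add (U : RO) (r x : S1) :
    itinerary U r (x + r) = shift (itinerary U r x) := by
  funext i
  change _ = itinerary U r x (i + 1)
  rw [itinerary_apply, itinerary_apply]
  refine if_congr ?_ rfl rfl
  rw [add_zsmul, one_zsmul, add_assoc x r, add_comm r]

lemma mem_goodSet_add {U : RO} {r x : S1} : x + r ∈ goodSet U r ↔ x ∈ goodSet U r := by
  simp only [mem_goodSet]
  constructor
  · intro h i
    have := h (i - 1)
    rwa [add_assoc, ← one_add_zsmul, add_sub_cancel] at this
  · intro h i
    have := h (i + 1)
    rwa [add_zsmul, one_zsmul, add_comm _ r, ← add_assoc] at this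

lemma goodSet_eq (U : RO) (r : S1) :
    goodSet U r = ⋂ i : ℤ, (fun x => x + i • r) ⁻¹' (frontier U.carrier)ᶜ := by
  ext x
  simp [mem_goodSet]

lemma measurableSet_goodSet (U : RO) (r : S1) : MeasurableSet (goodSet U r) := by
  rw [goodSet_eq]
  exact MeasurableSet.iInter fun i =>
    (measurable_add_const _) isClosed_frontier.measurableSet.compl

lemma measure_goodSet (U : RO0) (r : S1) : m (goodSet U.1 r)ᶜ = 0 := by
  rw [goodSet_eq, Set.compl_iInter, measure_iUnion_null_iff]
  intro i
  rw [← Set.preimage_compl, compl_compl, measure_preimage_add_right]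
  exact U.2

lemma measurable_itinerary (U : RO) (r : S1) : Measurable (itinerary U r) := by
  refine measurable_pi_lambda _ fun i => ?_
  refine Measurable.ite ?_ measurable_const measurable_const
  exact (rot r ^ i).continuous.measurable U.isOpen.measurableSet

/-- `Λ(U, r) = Cl(φ(B))`. -/
def LambdaSet (U : RO) (r : S1) : TopologicalSpace.Closeds Sigma2 :=
  TopologicalSpace.Closeds.closure (itinerary U r '' goodSet U r)

lemma LambdaSet_rotate (U : RO) (r η : S1) : LambdaSet (U.rotate η) r = LambdaSet U r := by
  unfold LambdaSet
  congr 1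
  ext s
  constructor
  · rintro ⟨x, hx, rfl⟩
    exact ⟨x - η, (mem_goodSet_rotate η).1 hx, (itinerary_rotate U r x η).symm⟩
  · rintro ⟨x, hx, rfl⟩
    refine ⟨x + η, (mem_goodSet_rotate η).2 (by simpa using hx), ?_⟩
    rw [itinerary_rotate, add_sub_cancel_right]

/-- The Borel measure `φ_*(m)`, where `φ` has domain `B`; thus a Borel set `A` has measure
`m {x ∈ B | φ(x) ∈ A}`. -/
def pushMeasure (U : RO) (r : S1) : Measure Sigma2 :=
  (m.restrict (goodSet U r)).map (itinerary U r)

lemma pushMeasure_apply (U : RO) (r : S1) {A : Set Sigma2} (hA : MeasurableSet A) :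
    pushMeasure U r A = m {x ∈ goodSet U r | itinerary U r x ∈ A} := by
  rw [pushMeasure, Measure.map_apply (measurable_itinerary U r) hA,
    Measure.restrict_apply (measurable_itinerary U r hA)]
  congr 1
  ext x
  exact and_comm

lemma pushMeasure_rotate (U : RO) (r η : S1) : pushMeasure (U.rotate η) r = pushMeasure U r := by
  ext A hA
  rw [pushMeasure_apply _ _ hA, pushMeasure_apply _ _ hA,
    ← measure_preimage_add_right m η {x ∈ goodSet (U.rotate η) r | _}]
  congr 1
  ext x
  simp [mem_goodSet_rotate, itinerary_rotate]

lemma measurePreserving_pushMeasure (U : RO) (r : S1) :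
    MeasurePreserving shift (pushMeasure U r) (pushMeasure U r) := by
  refine ⟨shift.continuous.measurable, ?_⟩
  ext A hA
  rw [Measure.map_apply shift.continuous.measurable hA, pushMeasure_apply _ _ hA,
    pushMeasure_apply _ _ (shift.continuous.measurable hA),
    ← measure_preimage_add_right m r {x ∈ goodSet U r | itinerary U r x ∈ A}]
  congr 1
  ext x
  simp [mem_goodSet_add, itinerary_add]

lemma isProbabilityMeasure_pushMeasure (U : RO0) (r : S1) :
    IsProbabilityMeasure (pushMeasure U.1 r) := by
  constructor
  rw [pushMeasure_apply _ _ MeasurableSet.univ]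
  simp only [Set.mem_univ, and_true, Set.ofPred_mem_eq]
  exact (prob_compl_eq_zero_iff (measurableSet_goodSet U.1 r)).1 (measure_goodSet U r)

/-- The invariant probability measure `λ(U, r) = φ_*(m)` of a regular open set with null
frontier. -/
def lambdaMeasure (U : RO0) (r : S1) : InvMeasure shift :=
  ⟨⟨pushMeasure U.1 r, isProbabilityMeasure_pushMeasure U r⟩, measurePreserving_pushMeasure U.1 r⟩

/-- The map `Λ` on `RO' × S1`. -/
def LambdaMap (z : RO' × S1) : TopologicalSpace.Closeds Sigma2 :=
  Quotient.lift (fun U : RO => LambdaSet U z.2)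
    (by
      rintro U V ⟨η, rfl⟩
      exact (LambdaSet_rotate U z.2 η).symm) z.1

/-- The map `λ` on `RO0' × S1`. -/
def lambdaMap (z : RO0' × S1) : InvMeasure shift :=
  Quotient.lift (fun U : RO0 => lambdaMeasure U z.2)
    (by
      rintro U V ⟨η, h⟩
      have h' : V.1 = U.1.rotate η := h
      refine Subtype.ext (Subtype.ext ?_)
      change pushMeasure U.1 z.2 = pushMeasure V.1 z.2
      rw [h', pushMeasure_rotate]) z.1

end DenjoyDisks

end

noncomputable section

namespace DenjoyDisks

open Set Filter

/-! ### The two sides of a regular open set -/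

/-! For a regular open set, `U` and its dual play symmetric roles: each symbol names an open side of
the circle, each side is the interior of its closure, and only the frontier lies on neither. A
finite word prescribes an open box. Since good points are dense, a sequence lies in `LambdaSet U r`
exactly when all its boxes are nonempty (`mem_LambdaSet_iff`). The measure of a box is continuous in
`(U, r)` because the metric controls both sides. That gives weak continuity of λ, and lower
semicontinuity of Λ because a nonempty open box has positive measure.

For an irrational angle, compatibility is relaxed to closed sides. The set `fib U a s` of points
whose orbit is so compatible with `s` is nonempty by compactness, and whenever such an orbit is off
the frontier it dictates the symbol of `s`. As orbits are dense, the shift orbit of any `s` in Λ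
enters every cylinder meeting Λ (minimality), and `s` alone determines `U` up to rotation
(injectivity). Two points of `fib U a s` differ by a symmetry of `U`. The symmetries form the
`n`-torsion of the circle for some `n`, so `U` is the pullback under `x ↦ n • x` of a set `V`
without symmetry, and Λ of `U` at `a` is Λ of `V` at `n • a`; this is the source of `n`. For `V`,
each sequence codes one point, and the coding map is a semiconjugacy injective over the good set. If
the frontier is null, every invariant measure projects to Haar measure and is determined by it.

If the frontier is finite, the countably many points whose orbits meet it are blown up to intervals.
The rotation lifts to a Denjoy homeomorphism, and one-sided symbols conjugate the set of uncollapsed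
points and interval ends with Λ; the two ends of an interval are told apart where the orbit meets
the frontier.

For `p / q`, itineraries are `q`-periodic. Conversely, an invariant measure on `q`-periodic
sequences is realized by cutting an arc of length `1 / q` into pieces proportional to the atoms and
letting each sequence tell which rotated copies of its piece belong to `U`. Constant point masses
fail because both sides of `U` have positive measure. -/

/-- Regularity enters here; it is what makes the two symbols interchangeable later. -/
lemma closure_dual (U : RO) : closure (dual U.carrier) = U.carrierᶜ := by
  rw [dual, interior_compl, closure_compl, U.regular]

lemma dual_eq (U : RO) : dual U.carrier = (closure U.carrier)ᶜ := by
  rw [dual, interior_compl]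

/-- The side of `U` prescribed by a symbol: `U` itself for `1`, and `U*` for `0`. -/
def RO.side (U : RO) (e : Fin 2) : Set S1 := if e = 1 then U.carrier else dual U.carrier

@[simp] lemma RO.side_one (U : RO) : U.side 1 = U.carrier := by simp [RO.side]

@[simp] lemma RO.side_zero (U : RO) : U.side 0 = dual U.carrier := by simp [RO.side]

lemma RO.isOpen_side (U : RO) (e : Fin 2) : IsOpen (U.side e) := by
  fin_cases e
  · simp [dual]
  · simpa using U.isOpen

lemma RO.interior_closure_side (U : RO) (e : Fin 2) : interior (closure (U.side e)) = U.side e := by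
  fin_cases e
  · simp only [Fin.zero_eta, RO.side_zero]
    rw [closure_dual, dual]
  · simpa using U.regular

lemma RO.side_inter_closure (U : RO) {e e' : Fin 2} (h : e ≠ e') {x : S1} (hx : x ∈ U.side e) :
    x ∉ closure (U.side e') := by
  fin_cases e <;> fin_cases e' <;> simp_all [dual_eq, U.regular]

lemma RO.side_unique (U : RO) {e e' : Fin 2} {x : S1} (hx : x ∈ U.side e) (hx' : x ∈ U.side e') :
    e = e' := by
  by_contra h
  exact U.side_inter_closure h hx (subset_closure hx')

lemma RO.notMem_frontier_iff (U : RO) {x : S1} :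
    x ∉ frontier U.carrier ↔ ∃ e, x ∈ U.side e := by
  rw [U.isOpen.frontier_eq]
  constructor
  · intro h
    by_cases hx : x ∈ U.carrier
    · exact ⟨1, by simpa⟩
    · refine ⟨0, ?_⟩
      rw [RO.side_zero, dual_eq]
      exact fun hc => h ⟨hc, hx⟩
  · rintro ⟨e, he⟩ ⟨h1, h2⟩
    fin_cases e
    · simp only [Fin.zero_eta, RO.side_zero, dual_eq] at he
      exact he h1
    · exact h2 (by simpa using he)

lemma RO.side_nonempty (U : RO) (e : Fin 2) : (U.side e).Nonempty := by
  fin_cases e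
  · simp only [Fin.zero_eta, RO.side_zero]
    by_contra h
    have := closure_dual U
    rw [not_nonempty_iff_eq_empty.1 h, closure_empty] at this
    exact U.ne_univ (by simpa using this.symm)
  · simpa using U.nonempty

lemma RO.frontier_nonempty (U : RO) : (frontier U.carrier).Nonempty := by
  by_contra h
  have h' : IsClopen U.carrier := by
    rw [isClopen_iff_frontier_eq_empty]
    exact not_nonempty_iff_eq_empty.1 h
  rcases isClopen_iff.1 h' with h0 | h0
  · exact U.nonempty.ne_empty h0
  · exact U.ne_univ h0

lemma RO.interior_frontier (U : RO) : interior (frontier U.carrier) = ∅ :=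
  by
  rw [← frontier_compl]
  exact _root_.interior_frontier U.isOpen.isClosed_compl

/-! ### Itineraries, cylinders and boxes. -/

lemma itinerary_eq_of_mem_side {U : RO} {r x : S1} {i : ℤ} {e : Fin 2}
    (h : x + i • r ∈ U.side e) : itinerary U r x i = e := by
  rw [itinerary_apply]
  fin_cases e
  · rw [if_neg]
    · simp
    · intro h1
      exact absurd (U.side_unique (e' := 1) h (by simpa using h1)) (by simp)
  · simp only [Fin.mk_one, RO.side_one] at h
    simp [h]

lemma mem_goodSet_of_mem_side {U : RO} {r x : S1} {s : Sigma2}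
    (h : ∀ i : ℤ, x + i • r ∈ U.side (s i)) : x ∈ goodSet U r :=
  mem_goodSet.2 fun i => U.notMem_frontier_iff.2 ⟨_, h i⟩

lemma mem_side_itinerary {U : RO} {r x : S1} (h : x ∈ goodSet U r) (i : ℤ) :
    x + i • r ∈ U.side (itinerary U r x i) := by
  obtain ⟨e, he⟩ := U.notMem_frontier_iff.1 (mem_goodSet.1 h i)
  rwa [itinerary_eq_of_mem_side he]

/-- Baire: the frontier of an open set has empty interior, so countably many dense open sets are
intersected. -/
lemma dense_goodSet (U : RO) (r : S1) : Dense (goodSet U r) := by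
  rw [goodSet_eq]
  refine dense_iInter_of_isOpen (fun i => ?_) fun i => ?_
  · exact isClosed_frontier.isOpen_compl.preimage (continuous_add_const _)
  · have : (fun x : S1 => x + i • r) = Homeomorph.addRight (i • r) := rfl
    rw [this]
    refine Dense.preimage ?_ (Homeomorph.addRight (i • r)).isOpenMap
    rw [← interior_eq_empty_iff_dense_compl]
    exact U.interior_frontier

/-- The cylinder of sequences which agree with `s` on `[-N, N]`. -/
def cyl (s : Sigma2) (N : ℕ) : Set Sigma2 := {t | ∀ i : ℤ, |i| ≤ N → t i = s i}

lemma mem_cyl_self (s : Sigma2) (N : ℕ) : s ∈ cyl s N := fun _ _ => rfl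

lemma cyl_eq_iInter (s : Sigma2) (N : ℕ) :
    cyl s N = ⋂ i ∈ Finset.Icc (-N : ℤ) N, (fun t : Sigma2 => t i) ⁻¹' {s i} := by
  ext t
  simp [cyl, abs_le]

lemma isOpen_cyl (s : Sigma2) (N : ℕ) : IsOpen (cyl s N) := by
  rw [cyl_eq_iInter]
  exact isOpen_biInter_finset fun i _ => (isOpen_discrete _).preimage (continuous_apply i)

lemma exists_cyl_subset {G : Set Sigma2} (hG : IsOpen G) {s : Sigma2} (hs : s ∈ G) :
    ∃ N, cyl s N ⊆ G := by
  obtain ⟨I, u, hu, hIG⟩ := isOpen_pi_iff.1 hG s hs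
  refine ⟨I.sup Int.natAbs, fun t ht => hIG fun i hi => ?_⟩
  have : t i = s i := ht i (by
    rw [Int.abs_eq_natAbs]
    exact_mod_cast Finset.le_sup (f := Int.natAbs) hi)
  rw [this]
  exact (hu i hi).2

/-- The points whose itinerary is controlled to agree with `s` on `[-N, N]`. -/
def box (U : RO) (r : S1) (s : Sigma2) (N : ℕ) : Set S1 :=
  {x | ∀ i : ℤ, |i| ≤ N → x + i • r ∈ U.side (s i)}

lemma box_eq_iInter (U : RO) (r : S1) (s : Sigma2) (N : ℕ) :
    box U r s N = ⋂ i ∈ Finset.Icc (-N : ℤ) N, (fun x : S1 => x + i • r) ⁻¹' U.side (s i) := by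
  ext t
  simp [box, abs_le]

lemma isOpen_box (U : RO) (r : S1) (s : Sigma2) (N : ℕ) : IsOpen (box U r s N) := by
  rw [box_eq_iInter]
  exact isOpen_biInter_finset fun i _ => (U.isOpen_side _).preimage (continuous_add_const _)

lemma mem_box_iff {U : RO} {r x : S1} (h : x ∈ goodSet U r) {s : Sigma2} {N : ℕ} :
    x ∈ box U r s N ↔ itinerary U r x ∈ cyl s N := by
  constructor
  · exact fun hx i hi => itinerary_eq_of_mem_side (hx i hi)
  · intro hx i hi
    rw [← hx i hi]
    exact mem_side_itinerary h i

/-- Boxes are open and good points are dense, so a nonempty box contains a point with a true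
itinerary. Closure in the shift space becomes a question about open sets of the circle. -/
lemma mem_LambdaSet_iff {U : RO} {r : S1} {s : Sigma2} :
    s ∈ (LambdaSet U r : Set Sigma2) ↔ ∀ N, (box U r s N).Nonempty := by
  change s ∈ closure _ ↔ _
  rw [mem_closure_iff]
  constructor
  · intro h N
    obtain ⟨_, ht, x, hx, rfl⟩ := h _ (isOpen_cyl s N) (mem_cyl_self s N)
    exact ⟨x, (mem_box_iff hx).2 ht⟩
  · intro h G hG hs
    obtain ⟨N, hN⟩ := exists_cyl_subset hG hs
    obtain ⟨x, hxb, hx⟩ := (dense_goodSet U r).inter_open_nonempty _ (isOpen_box U r s N) (h N)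
    exact ⟨_, hN ((mem_box_iff hx).1 hxb), x, hx, rfl⟩

lemma itinerary_mem_LambdaSet {U : RO} {r x : S1} (h : x ∈ goodSet U r) :
    itinerary U r x ∈ (LambdaSet U r : Set Sigma2) :=
  subset_closure ⟨x, h, rfl⟩

lemma LambdaSet_nonempty (U : RO) (r : S1) : (LambdaSet U r : Set Sigma2).Nonempty := by
  obtain ⟨x, hx⟩ := (dense_goodSet U r).nonempty
  exact ⟨_, itinerary_mem_LambdaSet hx⟩

lemma image_shift_itinerary (U : RO) (r : S1) :
    shift '' (itinerary U r '' goodSet U r) = itinerary U r '' goodSet U r := by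
  ext s
  constructor
  · rintro ⟨_, ⟨x, hx, rfl⟩, rfl⟩
    exact ⟨x + r, mem_goodSet_add.2 hx, itinerary_add U r x⟩
  · rintro ⟨x, hx, rfl⟩
    refine ⟨_, ⟨x - r, mem_goodSet_add.1 (by simpa using hx), rfl⟩, ?_⟩
    rw [← itinerary_add, sub_add_cancel]

lemma image_shift_LambdaSet (U : RO) (r : S1) :
    shift '' (LambdaSet U r : Set Sigma2) = LambdaSet U r := by
  change shift '' closure _ = closure _
  rw [shift.image_closure, image_shift_itinerary]

/-! ### Continuity of the measure of boxes -/

/-- The dual term of the metric matters here: with frontiers of positive measure, closeness of `U`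
and `V` alone would not control the duals. -/
lemma dist_side_le (U V : RO) (e : Fin 2) :
    m.real (symmDiff (U.side e) (V.side e)) ≤ 2 * dist U V := by
  have h : dist U V = (m.real (symmDiff U.carrier V.carrier) +
    m.real (symmDiff (dual U.carrier) (dual V.carrier))) / 2 := rfl
  have h1 : 0 ≤ m.real (symmDiff U.carrier V.carrier) := measureReal_nonneg
  have h2 : 0 ≤ m.real (symmDiff (dual U.carrier) (dual V.carrier)) := measureReal_nonneg
  rw [h]
  fin_cases e <;> simp <;> linarith

/-- Two perturbations are separated. Changing the set costs the same for every rotation, by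
invariance of Haar measure; rotating a fixed set is continuous in measure. -/
lemma tendsto_measure_side (U : RO) (r : S1) (i : ℤ) (e : Fin 2) :
    Tendsto (fun p : RO × S1 => m (symmDiff ((fun x : S1 => x + i • p.2) ⁻¹' p.1.side e)
      ((fun x : S1 => x + i • r) ⁻¹' U.side e))) (𝓝 (U, r)) (𝓝 0) := by
  have h1 : Tendsto (fun p : RO × S1 => m (symmDiff (p.1.side e) (U.side e))) (𝓝 (U, r)) (𝓝 0) := by
    have : Tendsto (fun p : RO × S1 => ENNReal.ofReal (2 * dist p.1 U)) (𝓝 (U, r)) (𝓝 0) := by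
      have h : Continuous fun p : RO × S1 => ENNReal.ofReal (2 * dist p.1 U) :=
        ENNReal.continuous_ofReal.comp (by fun_prop)
      simpa using h.tendsto (U, r)
    refine tendsto_of_tendsto_of_tendsto_of_le_of_le tendsto_const_nhds this
      (fun _ => zero_le) fun p => ?_
    rw [← ofReal_measureReal]
    exact ENNReal.ofReal_le_ofReal (dist_side_le _ _ _)
  let f : S1 → C(S1, S1) := fun t => ⟨fun x => x + i • t, continuous_add_const _⟩
  have hf : Continuous f := by
    refine ContinuousMap.continuous_of_continuous_uncurry f ?_
    change Continuous fun p : S1 × S1 => p.2 + i • p.1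
    fun_prop
  have h2 : Tendsto (fun p : RO × S1 => m (symmDiff ((fun x : S1 => x + i • p.2) ⁻¹' U.side e)
      ((fun x : S1 => x + i • r) ⁻¹' U.side e))) (𝓝 (U, r)) (𝓝 0) := by
    have := tendsto_measure_symmDiff_preimage_nhds_zero (μ := m) (ν := m)
      (l := 𝓝 (U, r)) (f := fun p : RO × S1 => f p.2)
      (g := f r) (s := U.side e) ((hf.comp continuous_snd).tendsto (U, r))
      (Eventually.of_forall fun p => measurePreserving_add_right m _)
      (measurePreserving_add_right m _) (U.isOpen_side e).nullMeasurableSet (measure_ne_top _ _)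
    exact this
  have h3 := h1.add h2
  rw [add_zero] at h3
  refine tendsto_of_tendsto_of_tendsto_of_le_of_le tendsto_const_nhds h3
      (fun _ => zero_le) fun p => ?_
  refine (measure_symmDiff_le _ ((fun x : S1 => x + i • p.2) ⁻¹' U.side e) _).trans ?_
  refine add_le_add (le_of_eq ?_) le_rfl
  rw [← preimage_symmDiff, measure_preimage_add_right]

lemma sdiff_iInter_subset {α ι : Type*} (I : Finset ι) (A B : ι → Set α) :
    (⋂ i ∈ I, A i) \ (⋂ i ∈ I, B i) ⊆ ⋃ i ∈ I, symmDiff (A i) (B i) := by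
  rintro x ⟨hA, hB⟩
  simp only [mem_iInter, not_forall] at hA hB
  obtain ⟨i, hi, hb⟩ := hB
  exact mem_biUnion hi (Or.inl ⟨hA i hi, hb⟩)

/-- A box is an intersection over a finite window, so its measure moves by at most the sum of the
symmetric differences of the factors. -/
lemma continuous_measure_box (s : Sigma2) (N : ℕ) :
    Continuous fun p : RO × S1 => m.real (box p.1 p.2 s N) := by
  rw [continuous_iff_continuousAt]
  rintro ⟨U, r⟩
  have h : Tendsto (fun p : RO × S1 => ∑ i ∈ Finset.Icc (-N : ℤ) N,
      m.real (symmDiff ((fun x : S1 => x + i • p.2) ⁻¹' p.1.side (s i))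
      ((fun x : S1 => x + i • r) ⁻¹' U.side (s i)))) (𝓝 (U, r)) (𝓝 0) := by
    have : Tendsto (fun p : RO × S1 => ∑ i ∈ Finset.Icc (-N : ℤ) N,
      m.real (symmDiff ((fun x : S1 => x + i • p.2) ⁻¹' p.1.side (s i))
      ((fun x : S1 => x + i • r) ⁻¹' U.side (s i)))) (𝓝 (U, r))
      (𝓝 (∑ i ∈ Finset.Icc (-N : ℤ) N, (0 : ENNReal).toReal)) :=
      tendsto_finsetSum _ fun i _ =>
        (ENNReal.tendsto_toReal (by simp)).comp (tendsto_measure_side U r i (s i))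
    simpa using this
  rw [ContinuousAt, tendsto_iff_dist_tendsto_zero]
  refine tendsto_of_tendsto_of_tendsto_of_le_of_le tendsto_const_nhds h
      (fun _ => dist_nonneg) fun p => ?_
  have key : ∀ (A B : ℤ → Set S1), m.real (⋂ i ∈ Finset.Icc (-N : ℤ) N, A i) -
      m.real (⋂ i ∈ Finset.Icc (-N : ℤ) N, B i) ≤
      ∑ i ∈ Finset.Icc (-N : ℤ) N, m.real (symmDiff (A i) (B i)) := by
    intro A B
    rw [sub_le_iff_le_add']
    calc m.real (⋂ i ∈ Finset.Icc (-N : ℤ) N, A i)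
        ≤ m.real ((⋂ i ∈ Finset.Icc (-N : ℤ) N, B i) ∪
            ⋃ i ∈ Finset.Icc (-N : ℤ) N, symmDiff (A i) (B i)) :=
          measureReal_mono (by
            rw [← sdiff_subset_iff]
            exact sdiff_iInter_subset _ _ _)
      _ ≤ _ := (measureReal_union_le _ _).trans (by
            gcongr
            exact measureReal_biUnion_finset_le _ _)
  simp only [box_eq_iInter, Real.dist_eq, abs_sub_le_iff]
  refine ⟨key _ _, (key _ _).trans_eq ?_⟩
  simp only [symmDiff_comm]

/-! ### Continuity of `λ` and lower semicontinuity of `Λ` -/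

lemma pushMeasure_cyl (U : RO0) (r : S1) (s : Sigma2) (N : ℕ) :
    pushMeasure U.1 r (cyl s N) = m (box U.1 r s N) := by
  rw [pushMeasure_apply _ _ (isOpen_cyl s N).measurableSet]
  refine measure_congr ?_
  have h : ∀ᵐ x ∂m, x ∈ goodSet U.1 r := measure_goodSet U r
  filter_upwards [h] with x hx
  exact propext ⟨fun h => (mem_box_iff hx).2 h.2, fun h => ⟨hx, (mem_box_iff hx).1 h⟩⟩

/-- The windows are nested, so two cylinders are nested or disjoint. -/
lemma isPiSystem_cyl : IsPiSystem {A : Set Sigma2 | ∃ s N, A = cyl s N} := by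
  have key : ∀ s t M N, M ≤ N → (cyl s M ∩ cyl t N).Nonempty → cyl s M ∩ cyl t N = cyl t N := by
    rintro s t M N h ⟨u, hu, hu'⟩
    refine inter_eq_right.2 fun v hv i hi => ?_
    have hi' : |i| ≤ (N : ℤ) := hi.trans (by exact_mod_cast h)
    rw [← hu i hi, hu' i hi', hv i hi']
  rintro _ ⟨s, M, rfl⟩ _ ⟨t, N, rfl⟩ h
  rcases le_total M N with hMN | hMN
  · exact ⟨t, N, key s t M N hMN h⟩
  · refine ⟨s, M, ?_⟩
    rw [inter_comm] at h ⊢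
    exact key t s N M hMN h

lemma continuous_lambdaMeasure : Continuous fun p : RO0 × S1 => lambdaMeasure p.1 p.2 := by
  refine Continuous.subtype_mk (f := fun p : RO0 × S1 => (lambdaMeasure p.1 p.2).1) ?_ _
  rw [continuous_iff_continuousAt]
  rintro ⟨U, r⟩
  refine isPiSystem_cyl.tendsto_probabilityMeasure_of_tendsto_of_mem ?_ ?_ ?_
  · rintro _ ⟨s, N, rfl⟩
    exact (isOpen_cyl s N).measurableSet
  · intro G hG s hs
    obtain ⟨N, hN⟩ := exists_cyl_subset hG hs
    exact ⟨_, ⟨s, N, rfl⟩, (isOpen_cyl s N).mem_nhds (mem_cyl_self s N), hN⟩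
  · rintro _ ⟨s, N, rfl⟩
    rw [← NNReal.tendsto_coe]
    have h : ∀ p : RO0 × S1, (((lambdaMeasure p.1 p.2).1 (cyl s N) : NNReal) : ℝ) =
        m.real (box p.1.1 p.2 s N) := fun p => by
      change (pushMeasure p.1.1 p.2 (cyl s N)).toReal = _
      rw [pushMeasure_cyl, measureReal_def]
    have hg : Continuous fun p : RO0 × S1 => ((p.1.1, p.2) : RO × S1) := by fun_prop
    have hc := (continuous_measure_box s N).comp hg
    exact (hc.congr fun p => (h p).symm).tendsto (U, r)

/-! ### Passage to the quotient by rotations. -/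

lemma continuous_rotate (η : S1) : Continuous (RO.rotate η) := by
  refine Isometry.continuous (Isometry.of_dist_eq fun U V => ?_)
  have h : ∀ A B : Set S1, m.real (symmDiff (rot η '' A) (rot η '' B)) = m.real (symmDiff A B) := by
    intro A B
    rw [← image_symmDiff (rot η).injective, measureReal_def, measureReal_def]
    change (m ((fun x => x + η) '' _)).toReal = _
    rw [image_add_right, measure_preimage_add_right]
  have hd : ∀ A : Set S1, dual (rot η '' A) = rot η '' dual A := by
    intro A
    rw [dual, dual, ← image_compl_eq (rot η).bijective, (rot η).image_interior]
  change (m.real (symmDiff (rot η '' _) (rot η '' _)) + m.real (symmDiff (dual (rot η '' _))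
    (dual (rot η '' _)))) / 2 = _
  rw [hd, hd, h, h]
  rfl

/-- The saturation of an open set is the union of its rotates. Openness survives the product with
the identity of the circle, so topological claims on the quotient can be checked upstairs. -/
lemma isOpenQuotientMap_mk : IsOpenQuotientMap (Quotient.mk rotSetoid) := by
  refine ⟨Quotient.mk_surjective, continuous_quot_mk, fun W hW => ?_⟩
  rw [isOpen_coinduced]
  have : Quotient.mk' ⁻¹' (Quotient.mk rotSetoid '' W) = ⋃ η, RO.rotate η ⁻¹' W := by
    ext U
    simp only [mem_preimage, mem_iUnion]
    constructor
    · rintro ⟨V, hV, h⟩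
      obtain ⟨η, rfl⟩ := (Quotient.exact h.symm : ∃ η, V = U.rotate η)
      exact ⟨η, hV⟩
    · rintro ⟨η, h⟩
      exact ⟨_, h, (Quotient.sound ⟨η, rfl⟩ : Quotient.mk rotSetoid U = _).symm⟩
  rw [this]
  exact isOpen_iUnion fun η => hW.preimage (continuous_rotate η)

lemma isOpenQuotientMap_mk0 : IsOpenQuotientMap (Quotient.mk rotSetoid0) := by
  have hfr : ∀ (U : RO0) (η : S1), m (frontier (U.1.rotate η).carrier) = 0 := by
    intro U η
    change m (frontier (rot η '' U.1.carrier)) = 0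
    rw [← (rot η).image_frontier]
    change m ((fun x => x + η) '' _) = _
    rw [image_add_right, measure_preimage_add_right, U.2]
  refine ⟨Quotient.mk_surjective, continuous_quot_mk, fun W hW => ?_⟩
  rw [isOpen_coinduced]
  have : Quotient.mk' ⁻¹' (Quotient.mk rotSetoid0 '' W) =
      ⋃ η, (fun U : RO0 => (⟨U.1.rotate η, hfr U η⟩ : RO0)) ⁻¹' W := by
    ext U
    simp only [mem_preimage, mem_iUnion]
    constructor
    · rintro ⟨V, hV, h⟩
      obtain ⟨η, h'⟩ := (Quotient.exact h.symm : ∃ η, V.1 = U.1.rotate η)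
      refine ⟨η, ?_⟩
      rwa [← show V = ⟨U.1.rotate η, hfr U η⟩ from Subtype.ext h']
    · rintro ⟨η, h⟩
      exact ⟨_, h, (Quotient.sound (show ∃ ξ, _ = _ from ⟨η, rfl⟩) :
        Quotient.mk rotSetoid0 U = _).symm⟩
  rw [this]
  exact isOpen_iUnion fun η => hW.preimage
    (((continuous_rotate η).comp continuous_subtype_val).subtype_mk _)

theorem continuous_lambdaMap : Continuous lambdaMap := by
  rw [← (isOpenQuotientMap_mk0.prodMap (IsOpenQuotientMap.id (X := S1))).continuous_comp_iff]
  exact continuous_lambdaMeasure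

theorem isLowerSemicontinuous_LambdaMap : IsLowerSemicontinuous LambdaMap := by
  intro Y hY
  rw [← (isOpenQuotientMap_mk.prodMap
    (IsOpenQuotientMap.id (X := S1))).isQuotientMap.isClosed_preimage, ← isOpen_compl_iff,
    isOpen_iff_mem_nhds]
  rintro ⟨U, r⟩ h
  have h' : ¬ (LambdaSet U r : Set Sigma2) ⊆ Y := h
  obtain ⟨s, hs, hsY⟩ := not_subset.1 h'
  obtain ⟨N, hN⟩ := exists_cyl_subset hY.isOpen_compl hsY
  -- A nonempty open box has positive measure, and this, unlike nonemptiness, visibly persists under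
  -- perturbation.
  have hpos : 0 < m.real (box U r s N) :=
    ENNReal.toReal_pos ((isOpen_box U r s N).measure_pos m (mem_LambdaSet_iff.1 hs N)).ne'
      (measure_ne_top _ _)
  filter_upwards [(continuous_measure_box s N).continuousAt.eventually_mem
    (isOpen_Ioi.mem_nhds hpos)] with p hp
  intro (hsub : (LambdaSet p.1 p.2 : Set Sigma2) ⊆ Y)
  have hne : (box p.1 p.2 s N).Nonempty := by
    rw [nonempty_iff_ne_empty]
    intro h0
    simp [h0] at hp
  obtain ⟨x, hxb, hx⟩ := (dense_goodSet p.1 p.2).inter_open_nonempty _ (isOpen_box _ _ s N) hne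
  exact hN ((mem_box_iff hx).1 hxb) (hsub (itinerary_mem_LambdaSet hx))

/-! ### Points of the circle compatible with a symbol sequence -/

/-- The points whose orbit is compatible with `s`, up to closure. -/
def fib (U : RO) (r : S1) (s : Sigma2) : Set S1 :=
  {y | ∀ i : ℤ, y + i • r ∈ closure (U.side (s i))}

/-- The finite-window conditions define nested compact sets, each containing a nonempty box. -/
lemma fib_nonempty {U : RO} {r : S1} {s : Sigma2} (hs : s ∈ (LambdaSet U r : Set Sigma2)) :
    (fib U r s).Nonempty := by
  let F : ℕ → Set S1 := fun N => {y | ∀ i : ℤ, |i| ≤ N → y + i • r ∈ closure (U.side (s i))}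
  have hcl : ∀ N, IsClosed (F N) := fun N => by
    simp only [F, ofPred_forall]
    exact isClosed_iInter fun i => isClosed_iInter fun _ =>
      isClosed_closure.preimage (continuous_add_const _)
  obtain ⟨y, hy⟩ := IsCompact.nonempty_iInter_of_sequence_nonempty_isCompact_isClosed F
    (fun N y (hy : y ∈ F (N + 1)) i hi => hy i (hi.trans (by push_cast; linarith)))
    (fun N => (mem_LambdaSet_iff.1 hs N).mono
      fun y (hy : y ∈ box U r s N) i hi => subset_closure (hy i hi))
    (hcl 0).isCompact hcl
  refine ⟨y, fun i => mem_iInter.1 hy i.natAbs i ?_⟩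
  rw [Int.abs_eq_natAbs]

lemma isClosed_fib_graph (U : RO) (r : S1) : IsClosed {p : Sigma2 × S1 | p.2 ∈ fib U r p.1} := by
  have : {p : Sigma2 × S1 | p.2 ∈ fib U r p.1} = ⋂ i : ℤ, ⋃ e : Fin 2,
      {p : Sigma2 × S1 | p.1 i = e} ∩ {p | p.2 + i • r ∈ closure (U.side e)} := by
    ext p
    simp [fib]
  rw [this]
  refine isClosed_iInter fun i => isClosed_iUnion_of_finite fun e => ?_
  refine ((isClosed_discrete ({e} : Set (Fin 2))).preimage
    (show Continuous fun p : Sigma2 × S1 => p.1 i by fun_prop)).inter ?_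
  exact isClosed_closure.preimage (continuous_snd.add continuous_const)

lemma add_mem_fib_shift {U : RO} {r : S1} {s : Sigma2} {y : S1} (hy : y ∈ fib U r s) :
    y + r ∈ fib U r (shift s) := by
  intro i
  have := hy (i + 1)
  rwa [add_zsmul, one_zsmul, add_comm _ r, ← add_assoc] at this

lemma mem_fib_itinerary {U : RO} {r x : S1} (hx : x ∈ goodSet U r) :
    x ∈ fib U r (itinerary U r x) :=
  fun i => subset_closure (mem_side_itinerary hx i)

/-- An open side misses the closure of the other side, so even weak compatibility forces the true
symbol off the frontier. -/
lemma eq_of_mem_side_of_mem_fib {U : RO} {r y : S1} {s : Sigma2} (hy : y ∈ fib U r s) {i : ℤ}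
    {e : Fin 2} (h : y + i • r ∈ U.side e) : s i = e := by
  by_contra hne
  exact U.side_inter_closure (Ne.symm hne) h (hy i)

lemma eq_itinerary_of_mem_fib {U : RO} {r y : S1} {s : Sigma2} (hg : y ∈ goodSet U r)
    (hy : y ∈ fib U r s) : s = itinerary U r y :=
  funext fun i => eq_of_mem_side_of_mem_fib hy (mem_side_itinerary hg i)

lemma DenseRange.add_left {a : S1} (ha : DenseRange fun i : ℤ => i • a) (y : S1) :
    DenseRange fun i : ℤ => y + i • a :=
  (Homeomorph.addLeft y).surjective.denseRange.comp ha (Homeomorph.addLeft y).continuous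

/-- When the orbit of `y` visits `U.side e`, the symbol of `s` is `e`, so the orbit of `y'` is in
the closed side of `V`. Such visits are dense in `U.side e`; regularity of `V` then removes the
closure. -/
lemma side_add_subset {U V : RO} {a y y' : S1} (ha : DenseRange fun i : ℤ => i • a) {s : Sigma2}
    (hy : y ∈ fib U a s) (hy' : y' ∈ fib V a s) (e : Fin 2) :
    U.side e ⊆ (fun x => x + (y' - y)) ⁻¹' V.side e := by
  have h1 : U.side e ⊆ (fun x => x + (y' - y)) ⁻¹' closure (V.side e) := by
    refine ((DenseRange.add_left ha y).open_subset_closure_inter (U.isOpen_side e)).trans ?_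
    refine closure_minimal ?_ (isClosed_closure.preimage (continuous_add_const _))
    rintro _ ⟨hx, i, rfl⟩
    have h : y' + i • a ∈ closure (V.side (s i)) := hy' i
    rw [eq_of_mem_side_of_mem_fib hy hx] at h
    change y + i • a + (y' - y) ∈ closure (V.side e)
    rwa [show y + i • a + (y' - y) = y' + i • a by abel]
  have h2 : IsOpen ((fun x => x - (y' - y)) ⁻¹' U.side e) :=
    (U.isOpen_side e).preimage (continuous_sub_right _)
  have h3 : (fun x => x - (y' - y)) ⁻¹' U.side e ⊆ V.side e := by
    rw [← V.interior_closure_side]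
    refine interior_maximal (fun x hx => ?_) h2
    simpa using h1 hx
  intro x hx
  exact h3 (by simpa using hx)

/-- A sequence determines the regular open set up to rotation. -/
lemma eq_rotate_of_mem_fib {U V : RO} {a y y' : S1} (ha : DenseRange fun i : ℤ => i • a)
    {s : Sigma2} (hy : y ∈ fib U a s) (hy' : y' ∈ fib V a s) : V = U.rotate (y' - y) := by
  refine RO.ext (Subset.antisymm ?_ ?_)
  · intro x hx
    refine ⟨x + (y - y'), ?_, by simp [rot, add_assoc]⟩
    simpa using side_add_subset ha hy' hy 1 (by simpa using hx)
  · rintro _ ⟨x, hx, rfl⟩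
    simpa [rot] using side_add_subset ha hy hy' 1 (by simpa using hx)

/-! ### Minimality and injectivity for irrational rotations -/

lemma shift_zpow_apply (s : Sigma2) (n i : ℤ) : (shift ^ n) s i = s (i + n) := by
  have h1 : ∀ (s : Sigma2) (i : ℤ), shift s i = s (i + 1) := fun _ _ => rfl
  have h2 : ∀ (s : Sigma2) (i : ℤ), shift⁻¹ s i = s (i - 1) := fun _ _ => rfl
  induction n generalizing i with
  | zero => simp
  | succ n ih =>
    rw [add_comm (n : ℤ), zpow_one_add, Homeomorph.mul_apply, h1, ih]
    congr 1
    ring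
  | pred n ih =>
    rw [sub_eq_neg_add (-(n : ℤ)), zpow_add, Homeomorph.mul_apply, zpow_neg_one, h2, ih]
    congr 1
    ring

theorem isMinimalSet_LambdaSet (U : RO) {a : S1} (ha : DenseRange fun i : ℤ => i • a) :
    IsMinimalSet shift (LambdaSet U a : Set Sigma2) where
  isCompact := (LambdaSet U a).isClosed.isCompact
  nonempty := LambdaSet_nonempty U a
  invariant := image_shift_LambdaSet U a
  dense_orbit := by
    intro s hs t ht
    rw [mem_closure_iff]
    intro G hG htG
    obtain ⟨N, hN⟩ := exists_cyl_subset hG htG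
    obtain ⟨y, hy⟩ := fib_nonempty hs
    -- When the orbit of `y` enters the box of `t`, the symbols of `s` around time `j` must spell
    -- `t` on the window.
    obtain ⟨j, hj⟩ := (DenseRange.add_left ha y).exists_mem_open (isOpen_box U a t N)
      (mem_LambdaSet_iff.1 ht N)
    refine ⟨(shift ^ j) s, hN fun i hi => ?_, j, rfl⟩
    rw [shift_zpow_apply]
    refine eq_of_mem_side_of_mem_fib hy ?_
    have := hj i hi
    rwa [add_assoc, ← add_zsmul, add_comm j] at this

lemma exists_rotate_of_LambdaSet_eq {U V : RO} {a : S1} (ha : DenseRange fun i : ℤ => i • a)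
    (h : (LambdaSet U a : Set Sigma2) ⊆ LambdaSet V a) : ∃ η, V = U.rotate η := by
  obtain ⟨s, hs⟩ := LambdaSet_nonempty U a
  obtain ⟨y, hy⟩ := fib_nonempty hs
  obtain ⟨y', hy'⟩ := fib_nonempty (h hs)
  exact ⟨_, eq_rotate_of_mem_fib ha hy hy'⟩

theorem injective_LambdaMap {a : S1} (ha : DenseRange fun i : ℤ => i • a) :
    Function.Injective fun u : RO' => LambdaMap (u, a) := by
  intro u v
  induction u, v using Quotient.inductionOn₂ with
  | h U V =>
    intro (h : LambdaSet U a = LambdaSet V a)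
    exact Quotient.sound (exists_rotate_of_LambdaSet_eq ha (by rw [h]))

lemma pushMeasure_compl_LambdaSet (U : RO) (r : S1) :
    pushMeasure U r (LambdaSet U r : Set Sigma2)ᶜ = 0 := by
  rw [pushMeasure_apply _ _ (LambdaSet U r).isClosed.isOpen_compl.measurableSet]
  convert measure_empty (μ := m)
  ext x
  simp only [mem_ofPred_eq, mem_compl_iff, mem_empty_iff_false, iff_false, not_and, not_not]
  exact fun hx => itinerary_mem_LambdaSet hx

/-- Every cylinder around a point of Λ has positive mass, so Λ is recovered from λ and injectivity
of λ reduces to that of Λ. -/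
lemma LambdaSet_subset_of_pushMeasure (U : RO0) (r : S1) {Y : Set Sigma2} (hY : IsClosed Y)
    (h : pushMeasure U.1 r Yᶜ = 0) : (LambdaSet U.1 r : Set Sigma2) ⊆ Y := by
  intro s hs
  by_contra hsY
  obtain ⟨N, hN⟩ := exists_cyl_subset hY.isOpen_compl hsY
  have h0 := measure_mono_null hN h
  rw [pushMeasure_cyl] at h0
  exact ((isOpen_box U.1 r s N).measure_pos m (mem_LambdaSet_iff.1 hs N)).ne' h0

theorem injective_lambdaMap {a : S1} (ha : DenseRange fun i : ℤ => i • a) :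
    Function.Injective fun u : RO0' => lambdaMap (u, a) := by
  intro u v
  induction u, v using Quotient.inductionOn₂ with
  | h U V =>
    intro (h : lambdaMeasure U a = lambdaMeasure V a)
    have h' : pushMeasure U.1 a = pushMeasure V.1 a :=
      congrArg (fun μ : InvMeasure shift => (μ.1 : Measure Sigma2)) h
    refine Quotient.sound (show ∃ η, _ = _ from exists_rotate_of_LambdaSet_eq ha ?_)
    refine LambdaSet_subset_of_pushMeasure U a (LambdaSet V.1 a).isClosed ?_
    rw [h', pushMeasure_compl_LambdaSet]

/-! ### Reduction to regular open sets without rotational symmetry -/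

/-- `U` has no rotational symmetry. -/
def RO.Aperiodic (U : RO) : Prop := ∀ η : S1, U.rotate η = U → η = 0

lemma RO.Aperiodic.fib_subsingleton {U : RO} (hU : U.Aperiodic) {a : S1}
    (ha : DenseRange fun i : ℤ => i • a) (s : Sigma2) : (fib U a s).Subsingleton := by
  intro y hy y' hy'
  exact (sub_eq_zero.1 (hU _ (eq_rotate_of_mem_fib ha hy hy').symm)).symm

/-- The rotations preserving `U`. -/
def RO.symmetries (U : RO) : AddSubgroup S1 where
  carrier := {η | ∀ x, x + η ∈ U.carrier ↔ x ∈ U.carrier}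
  zero_mem' := by simp
  add_mem' := by
    intro η ξ hη hξ x
    rw [← add_assoc, hξ, hη]
  neg_mem' := by
    intro η hη x
    rw [← hη (x + -η), neg_add_cancel_right]

lemma RO.mem_symmetries {U : RO} {η : S1} :
    η ∈ U.symmetries ↔ ∀ x, x + η ∈ U.carrier ↔ x ∈ U.carrier := Iff.rfl

lemma RO.mem_symmetries_of_rotate_eq {U : RO} {η : S1} (h : U.rotate η = U) :
    η ∈ U.symmetries := by
  intro x
  have : U.carrier = rot η '' U.carrier := congrArg RO.carrier h.symm
  conv_lhs => rw [this]
  exact (rot η).injective.mem_set_image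

/-- A dense group of symmetries would spread `U` over the whole circle. A subgroup that is not dense
is cyclic of some finite order `n`; it lies in the `n`-torsion, which has at most `n` elements, so
it is all of it. -/
lemma RO.exists_symmetries_eq (U : RO) :
    ∃ n : ℕ, 1 ≤ n ∧ ∀ η : S1, η ∈ U.symmetries ↔ n • η = 0 := by
  have h : ¬ Dense (U.symmetries : Set S1) := by
    intro hd
    refine U.ne_univ (eq_univ_of_forall fun z => ?_)
    have ho : IsOpen ((fun η => z - η) ⁻¹' U.carrier) :=
      U.isOpen.preimage (continuous_sub_left z)
    obtain ⟨u, hu⟩ := U.nonempty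
    obtain ⟨η, hη, hηs⟩ := hd.inter_open_nonempty _ ho ⟨z - u, by simpa using hu⟩
    have := (RO.mem_symmetries.1 hηs (z - η)).2 hη
    simpa using this
  rw [AddCircle.dense_addSubgroup_iff_ne_zmultiples] at h
  push Not at h
  obtain ⟨b, hb, hs⟩ := h
  refine ⟨addOrderOf b, Nat.pos_of_ne_zero hb, fun η => ?_⟩
  have hfin : IsOfFinAddOrder b := addOrderOf_ne_zero_iff.1 hb
  have hsub : (AddSubgroup.zmultiples b : Set S1) ⊆ {u : S1 | addOrderOf b • u = 0} := by
    rintro _ ⟨k, rfl⟩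
    simp only [mem_ofPred_eq]
    rw [smul_comm, addOrderOf_nsmul_eq_zero, smul_zero]
  have hT : {u : S1 | addOrderOf b • u = 0}.Finite :=
    AddCircle.finite_torsion 1 (Nat.pos_of_ne_zero hb)
  have heq : (AddSubgroup.zmultiples b : Set S1) = {u : S1 | addOrderOf b • u = 0} := by
    refine eq_of_subset_of_ncard_le hsub ?_ hT
    have h1 : (AddSubgroup.zmultiples b : Set S1).ncard = addOrderOf b := by
      rw [← Nat.card_zmultiples]
      rfl
    have h2 := AddCircle.card_torsion_le_of_isSMulRegular (1 : ℝ) _ hb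
      (IsSMulRegular.of_right_eq_zero_of_smul fun _ => by simp [hb])
    rw [h1, ncard_def]
    exact ENat.toNat_le_of_le_natCast h2
  rw [hs]
  exact Set.ext_iff.1 heq η

lemma nsmul_surjective {n : ℕ} (hn : 1 ≤ n) : Function.Surjective fun x : S1 => n • x := by
  intro x
  obtain ⟨t, rfl⟩ := QuotientAddGroup.mk_surjective x
  refine ⟨((t / n : ℝ) : S1), ?_⟩
  change n • ((t / n : ℝ) : S1) = (t : S1)
  rw [← AddCircle.coe_nsmul, nsmul_eq_mul, mul_div_cancel₀ _ (by positivity)]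

lemma isOpenMap_nsmul {n : ℕ} (hn : 1 ≤ n) : IsOpenMap fun x : S1 => n • x :=
  AddMonoidHom.isOpenMap_of_sigmaCompact (nsmulAddMonoidHom n : S1 →+ S1) (nsmul_surjective hn)
    (continuous_const_smul n)

lemma measurePreserving_nsmul {n : ℕ} (hn : 1 ≤ n) :
    MeasurePreserving (fun x : S1 => n • x) m m :=
  AddMonoidHom.measurePreserving (f := (nsmulAddMonoidHom n : S1 →+ S1))
    (continuous_const_smul n) (nsmul_surjective hn) rfl

/-- The fibres of `x ↦ n • x` are the cosets of the symmetry group, so `U` is saturated and descends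
to its image. A symmetry of the image lifts to one of `U`, which multiplication by `n` kills. -/
lemma RO.exists_aperiodic (U : RO) :
    ∃ n : ℕ, 1 ≤ n ∧ ∃ V : RO, V.Aperiodic ∧ U.carrier = (fun x => n • x) ⁻¹' V.carrier := by
  obtain ⟨n, hn, hs⟩ := U.exists_symmetries_eq
  let f : S1 → S1 := fun x => n • x
  have hf : Continuous f := continuous_const_smul n
  have hpre : f ⁻¹' (f '' U.carrier) = U.carrier := by
    refine Subset.antisymm ?_ (subset_preimage_image _ _)
    rintro x ⟨u, hu, hux⟩
    have h : x - u ∈ U.symmetries := (hs _).2 (by rw [smul_sub, sub_eq_zero]; exact hux.symm)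
    simpa using (h u).2 hu
  refine ⟨n, hn, ⟨f '' U.carrier, U.nonempty.image f, fun h => U.ne_univ ?_, ?_⟩, ?_, hpre.symm⟩
  · rw [← hpre, h, preimage_univ]
  · refine (nsmul_surjective hn).preimage_injective ?_
    change f ⁻¹' _ = f ⁻¹' _
    rw [(isOpenMap_nsmul hn).preimage_interior_eq_interior_preimage hf,
      (isOpenMap_nsmul hn).preimage_closure_eq_closure_preimage hf]
    change interior (closure (f ⁻¹' _)) = _
    rw [hpre, U.regular]
  · intro η hη
    obtain ⟨ξ, rfl⟩ := nsmul_surjective hn η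
    refine (hs ξ).1 fun x => ?_
    have := RO.mem_symmetries_of_rotate_eq hη (f x)
    change f x + f ξ ∈ f '' _ ↔ f x ∈ f '' _ at this
    rw [← hpre]
    change f (x + ξ) ∈ f '' U.carrier ↔ f x ∈ f '' U.carrier
    rwa [show f (x + ξ) = f x + f ξ from smul_add n x ξ]

lemma RO.side_eq_preimage {U V : RO} {n : ℕ} (hn : 1 ≤ n)
    (h : U.carrier = (fun x => n • x) ⁻¹' V.carrier) (e : Fin 2) :
    U.side e = (fun x => n • x) ⁻¹' V.side e := by
  fin_cases e
  · simp only [Fin.zero_eta, RO.side_zero, dual]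
    rw [(isOpenMap_nsmul hn).preimage_interior_eq_interior_preimage (continuous_const_smul n), h]
    rfl
  · simpa using h

lemma RO.frontier_eq_preimage {U V : RO} {n : ℕ} (hn : 1 ≤ n)
    (h : U.carrier = (fun x => n • x) ⁻¹' V.carrier) :
    frontier U.carrier = (fun x => n • x) ⁻¹' frontier V.carrier := by
  rw [(isOpenMap_nsmul hn).preimage_frontier_eq_frontier_preimage (continuous_const_smul n), h]

/-- Boxes of `U` are preimages of boxes of `V` under a surjection, so they are nonempty together. -/
lemma LambdaSet_eq_of_preimage {U V : RO} {n : ℕ} (hn : 1 ≤ n)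
    (h : U.carrier = (fun x => n • x) ⁻¹' V.carrier) (a : S1) :
    LambdaSet U a = LambdaSet V (n • a) := by
  refine SetLike.coe_injective (Set.ext fun s => ?_)
  rw [mem_LambdaSet_iff, mem_LambdaSet_iff]
  refine forall_congr' fun N => ?_
  have : box U a s N = (fun x => n • x) ⁻¹' box V (n • a) s N := by
    ext x
    simp only [box, RO.side_eq_preimage hn h, mem_preimage, mem_ofPred_eq, smul_add,
      smul_comm n]
  rw [this, (nsmul_surjective hn).nonempty_preimage]

/-! ### The factor map onto the circle -/

/-- The point of the circle coded by a sequence; it is unique if `U` is aperiodic and the rotation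
is irrational. -/
def code (U : RO) (a : S1) (s : (LambdaSet U a : Set Sigma2)) : S1 := (fib_nonempty s.2).some

lemma code_mem_fib (U : RO) (a : S1) (s : (LambdaSet U a : Set Sigma2)) :
    code U a s ∈ fib U a s := (fib_nonempty s.2).some_mem

section

variable {U : RO} {a : S1} (hU : U.Aperiodic) (ha : DenseRange fun i : ℤ => i • a)
include hU ha

lemma code_eq_iff {s : (LambdaSet U a : Set Sigma2)} {y : S1} :
    code U a s = y ↔ y ∈ fib U a s :=
  ⟨fun h => h ▸ code_mem_fib U a s,
    fun h => hU.fib_subsingleton ha s (code_mem_fib U a s) h⟩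

lemma continuous_code : Continuous (code U a) := by
  have : CompactSpace (LambdaSet U a : Set Sigma2) :=
    isCompact_iff_compactSpace.1 (LambdaSet U a).isClosed.isCompact
  rw [continuous_iff_isClosed]
  intro C hC
  have h1 : IsClosed {p : ↥(LambdaSet U a : Set Sigma2) × S1 | p.2 ∈ fib U a p.1 ∧ p.2 ∈ C} :=
    ((isClosed_fib_graph U a).preimage
      (show Continuous fun p : ↥(LambdaSet U a : Set Sigma2) × S1 => ((p.1 : Sigma2), p.2) by
        fun_prop)).inter (hC.preimage continuous_snd)
  -- Uniqueness of the coded point makes the closed fibre relation the graph of `code`; projecting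
  -- along the compact circle preserves closedness.
  convert isClosedMap_fst_of_compactSpace _ h1
  ext s
  constructor
  · exact fun hs => ⟨(s, code U a s), ⟨code_mem_fib U a s, hs⟩, rfl⟩
  · rintro ⟨⟨s', y⟩, ⟨h, hy⟩, rfl⟩
    change code U a s' ∈ C
    rwa [(code_eq_iff hU ha).2 h]

lemma code_shift (s : (LambdaSet U a : Set Sigma2))
    (hs : shift s ∈ (LambdaSet U a : Set Sigma2)) :
    code U a ⟨shift s, hs⟩ = rot a (code U a s) :=
  (code_eq_iff hU ha).2 (add_mem_fib_shift (code_mem_fib U a s))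

lemma code_itinerary {x : S1} (hx : x ∈ goodSet U a) :
    code U a ⟨itinerary U a x, itinerary_mem_LambdaSet hx⟩ = x :=
  (code_eq_iff hU ha).2 (mem_fib_itinerary hx)

lemma surjective_code : Function.Surjective (code U a) := by
  have : CompactSpace (LambdaSet U a : Set Sigma2) :=
    isCompact_iff_compactSpace.1 (LambdaSet U a).isClosed.isCompact
  have hd : DenseRange (code U a) :=
    (dense_goodSet U a).mono fun x hx => ⟨_, code_itinerary hU ha hx⟩
  rw [← range_eq_univ, ← (isCompact_range (continuous_code hU ha)).isClosed.closure_eq]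
  exact hd.closure_range

omit hU ha in
lemma eq_of_code_mem_goodSet {s t : (LambdaSet U a : Set Sigma2)}
    (hs : code U a s ∈ goodSet U a) (h : code U a t = code U a s) : t = s := by
  refine Subtype.ext ?_
  rw [eq_itinerary_of_mem_fib hs (code_mem_fib U a s),
    eq_itinerary_of_mem_fib (h ▸ hs) (code_mem_fib U a t), h]

omit hU ha in
lemma isGδ_goodSet (U : RO) (a : S1) : IsGδ (goodSet U a) := by
  rw [goodSet_eq]
  exact .iInter fun i =>
    (isClosed_frontier.isOpen_compl.preimage (continuous_add_const _)).isGδ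

omit hU ha in
lemma dense_itinerary (U : RO) (a : S1) : Dense {s : (LambdaSet U a : Set Sigma2) |
    ∃ x ∈ goodSet U a, (s : Sigma2) = itinerary U a x} := by
  intro s
  rw [closure_subtype]
  convert s.2
  change closure _ = closure _
  congr 1
  ext t
  constructor
  · rintro ⟨t, ⟨x, hx, h⟩, rfl⟩
    exact ⟨x, hx, h.symm⟩
  · rintro ⟨x, hx, rfl⟩
    exact ⟨⟨_, itinerary_mem_LambdaSet hx⟩, ⟨x, hx, rfl⟩, rfl⟩

theorem isAlmostOneToOneExtension_of_aperiodic :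
    IsAlmostOneToOneExtension shift (LambdaSet U a : Set Sigma2) (rot a) := by
  refine ⟨image_shift_LambdaSet U a, code U a, continuous_code hU ha, surjective_code hU ha,
    code_shift hU ha, code U a ⁻¹' goodSet U a, ?_, ?_, ?_⟩
  · exact (isGδ_goodSet U a).preimage (continuous_code hU ha)
  · refine (dense_itinerary U a).mono ?_
    rintro ⟨_, hs⟩ ⟨x, hx, rfl⟩
    rwa [mem_preimage, code_itinerary hU ha hx]
  · exact fun s hs t h => eq_of_code_mem_goodSet hs h

/-! ### Unique ergodicity -/

omit hU in
-- Invariance passes to all multiples of `a`, then to every translation, since the integral of a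
-- translated continuous function depends continuously on the translation. Haar measure is unique.
lemma eq_haar_of_invariant {ν : Measure S1} [IsProbabilityMeasure ν]
    (hν : MeasurePreserving (rot a) ν ν) : ν = m := by
  have hinv : ∀ t : S1, ν.map (fun x => x + t) = ν := by
    have hz : ∀ i : ℤ, ν.map (fun x => x + i • a) = ν := by
      have h1 : ν.map (fun x => x + a) = ν := hν.map_eq
      have h2 : ∀ i : ℤ, ν.map (fun x => x + (i + 1) • a) = ν.map (fun x => x + i • a) := by
        intro i
        conv_rhs => rw [← h1]
        rw [Measure.map_map (by fun_prop) (by fun_prop)]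
        congr 1
        funext x
        simp only [Function.comp_apply, add_zsmul, one_zsmul]
        abel
      intro i
      induction i with
      | zero => simp
      | succ i ih => rw [h2, ih]
      | pred i ih => rw [← h2, sub_add_cancel, ih]
    intro t
    refine ext_of_forall_integral_eq_of_IsFiniteMeasure fun f => ?_
    rw [integral_map (by fun_prop) (by fun_prop)]
    have hc : Continuous fun t : S1 => ∫ x, f (x + t) ∂ν :=
      continuous_of_dominated (F := fun t x => f (x + t)) (bound := fun _ => ‖f‖)
        (fun t => (f.continuous.comp (continuous_add_const t)).aestronglyMeasurable)
        (fun t => Eventually.of_forall fun x => f.norm_coe_le_norm _)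
        (integrable_const _)
        (Eventually.of_forall fun x => f.continuous.comp (continuous_const_add x))
    have := ha.equalizer hc continuous_const (funext fun i => by
      change ∫ x, f (x + i • a) ∂ν = ∫ x, f x ∂ν
      conv_rhs => rw [← hz i]
      rw [integral_map (by fun_prop) (by fun_prop)])
    exact congrFun this t
  have : ν.IsAddLeftInvariant := ⟨fun t => by simpa only [add_comm] using hinv t⟩
  have : ν.IsAddHaarMeasure := Measure.isAddHaarMeasure_of_isCompact_nonempty_interior ν univ
    isCompact_univ (by simp) (by simp) (by simp)
  exact Measure.isAddHaarMeasure_eq_of_isProbabilityMeasure _ _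

/-- The coding map sends `μ` to Haar measure, and almost every sequence is alone in its fibre, so
`A` is saturated up to a null set. The right side no longer involves `μ`. -/
lemma measure_eq_of_isClosed (hfr : m (frontier U.carrier) = 0) {μ : InvMeasure shift}
    (hμ : (μ.1 : Measure Sigma2) (LambdaSet U a : Set Sigma2)ᶜ = 0) {A : Set Sigma2}
    (hA : IsClosed A) :
    (μ.1 : Measure Sigma2) A = m (code U a '' (Subtype.val ⁻¹' A)) := by
  set L : Set Sigma2 := (LambdaSet U a : Set Sigma2) with hL
  have hLm : MeasurableSet L := (LambdaSet U a).isClosed.measurableSet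
  have : CompactSpace L := isCompact_iff_compactSpace.1 (LambdaSet U a).isClosed.isCompact
  set ν : Measure L := (μ.1 : Measure Sigma2).comap Subtype.val with hν
  have hcomap : ∀ B : Set Sigma2, MeasurableSet B →
      ν (Subtype.val ⁻¹' B) = (μ.1 : Measure Sigma2) B := by
    intro B hB
    rw [hν, comap_subtype_coe_apply hLm, Subtype.image_preimage_coe, inter_comm]
    refine measure_inter_conull hμ
  have hprob : IsProbabilityMeasure ν := ⟨by
    simpa using hcomap univ MeasurableSet.univ⟩
  have hc := continuous_code hU ha
  have hpush : ν.map (code U a) = m := by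
    have : IsProbabilityMeasure (ν.map (code U a)) :=
      Measure.isProbabilityMeasure_map hc.aemeasurable
    refine eq_haar_of_invariant ha ⟨(rot a).continuous.measurable, ?_⟩
    ext C hC
    have hCm := hc.measurable hC
    -- Measurable subsets of `L` are traces of Borel sets, so invariance can be used in the full
    -- shift space.
    obtain ⟨B, hB, hBC⟩ := hCm
    have hrot : (code U a) ⁻¹' (rot a ⁻¹' C) = Subtype.val ⁻¹' (shift ⁻¹' B) := by
      ext s
      have hs : shift s ∈ L := (image_shift_LambdaSet U a).subset (mem_image_of_mem _ s.2)
      have := Set.ext_iff.1 hBC ⟨shift s, hs⟩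
      simp only [mem_preimage] at this ⊢
      rw [this, code_shift hU ha]
    rw [Measure.map_apply (rot a).continuous.measurable hC,
      Measure.map_apply hc.measurable ((rot a).continuous.measurable hC), hrot,
      Measure.map_apply hc.measurable hC, ← hBC, hcomap _ (shift.continuous.measurable hB),
      hcomap _ hB]
    exact μ.2.measure_preimage hB.nullMeasurableSet
  have hAc : IsClosed (code U a '' (Subtype.val ⁻¹' A)) :=
    ((hA.preimage continuous_subtype_val).isCompact.image hc).isClosed
  rw [← hpush, Measure.map_apply hc.measurable hAc.measurableSet, ← hcomap A hA.measurableSet]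
  refine measure_congr ?_
  have hg : ∀ᵐ s ∂ν, code U a s ∈ goodSet U a := by
    have h1 : ∀ᵐ x ∂(ν.map (code U a)), x ∈ goodSet U a := by
      rw [hpush]
      exact measure_goodSet ⟨U, hfr⟩ a
    exact ae_of_ae_map hc.aemeasurable h1
  filter_upwards [hg] with s hs
  refine propext ⟨fun h => ⟨s, h, rfl⟩, ?_⟩
  rintro ⟨t, ht, hts⟩
  rwa [eq_of_code_mem_goodSet hs hts] at ht

theorem isUniquelyErgodic_of_aperiodic (hfr : m (frontier U.carrier) = 0) :
    IsUniquelyErgodic shift (LambdaSet U a : Set Sigma2) := by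
  refine ⟨lambdaMeasure ⟨U, hfr⟩ a, pushMeasure_compl_LambdaSet U a, fun μ hμ => ?_⟩
  have : IsProbabilityMeasure (pushMeasure U a) := isProbabilityMeasure_pushMeasure ⟨U, hfr⟩ a
  have h : (μ.1 : Measure Sigma2) = pushMeasure U a := by
    refine ext_of_generate_finite {A | IsClosed A} ?_ isPiSystem_isClosed (fun A hA => ?_) (by simp)
    · rw [← borel_eq_generateFrom_isClosed]
      exact BorelSpace.measurable_eq
    · rw [measure_eq_of_isClosed hU ha hfr hμ hA]
      exact (measure_eq_of_isClosed hU ha hfr (μ := lambdaMeasure ⟨U, hfr⟩ a)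
        (pushMeasure_compl_LambdaSet U a) hA).symm
  exact Subtype.ext (Subtype.ext h)

end

/-! ### Blowing up orbits of a rotation -/

/-- Summable nonnegative weights on the circle, of total mass less than one. -/
structure Weight where
  w : S1 → ℝ
  nonneg : ∀ e, 0 ≤ w e
  summable : Summable w
  tsum_lt_one : ∑' e, w e < 1

namespace Weight

variable (ω : Weight)

/-- A representative in `[0, 1)` of a point of the circle. -/
def rep (e : S1) : ℝ := (AddCircle.equivIco 1 0 e : ℝ)

lemma rep_mem (e : S1) : 0 ≤ rep e ∧ rep e < 1 := by
  simpa [rep] using (AddCircle.equivIco 1 0 e).2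

lemma coe_rep (e : S1) : ((rep e : ℝ) : S1) = e := AddCircle.coe_equivIco

/-- The left end of the interval replacing `x`. -/
def left (x : ℝ) : ℝ := (1 - ∑' e, ω.w e) * x + ∑' e, ω.w e * ⌈x - rep e⌉

/-- The right end of the interval replacing `x`. -/
def right (x : ℝ) : ℝ := (1 - ∑' e, ω.w e) * x + ∑' e, ω.w e * (⌊x - rep e⌋ + 1)

lemma abs_ceil_le (x : ℝ) (e : S1) : |(⌈x - rep e⌉ : ℝ)| ≤ |x| + 2 := by
  have h := rep_mem e
  have h1 := Int.ceil_lt_add_one (x - rep e)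
  have h2 := Int.le_ceil (x - rep e)
  rw [abs_le]
  constructor <;> linarith [neg_abs_le x, le_abs_self x]

lemma abs_floor_le (x : ℝ) (e : S1) : |(⌊x - rep e⌋ + 1 : ℝ)| ≤ |x| + 2 := by
  have h := rep_mem e
  have h1 := Int.lt_floor_add_one (x - rep e)
  have h2 := Int.floor_le (x - rep e)
  rw [abs_le]
  constructor <;> linarith [neg_abs_le x, le_abs_self x]

lemma norm_mul_le {k : ℝ} {C : ℝ} (e : S1) (h : |k| ≤ C) : ‖ω.w e * k‖ ≤ ω.w e * C := by
  rw [norm_mul, Real.norm_of_nonneg (ω.nonneg e), Real.norm_eq_abs]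
  exact mul_le_mul_of_nonneg_left h (ω.nonneg e)

lemma summable_ceil (x : ℝ) : Summable fun e => ω.w e * (⌈x - rep e⌉ : ℝ) :=
  Summable.of_norm_bounded (ω.summable.mul_right (|x| + 2))
    fun e => ω.norm_mul_le e (abs_ceil_le x e)

lemma summable_floor (x : ℝ) : Summable fun e => ω.w e * (⌊x - rep e⌋ + 1 : ℝ) :=
  Summable.of_norm_bounded (ω.summable.mul_right (|x| + 2))
    fun e => ω.norm_mul_le e (abs_floor_le x e)

/-- The coefficient `1 - ∑' e, ω.w e` compensates for the total length inserted in one period. -/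
lemma left_add_one (x : ℝ) : ω.left (x + 1) = ω.left x + 1 := by
  have h : ∀ e, ω.w e * (⌈x + 1 - rep e⌉ : ℝ) = ω.w e * ⌈x - rep e⌉ + ω.w e := fun e => by
    rw [show x + 1 - rep e = x - rep e + 1 by ring, Int.ceil_add_one]
    push_cast
    ring
  simp only [left, h]
  rw [(ω.summable_ceil x).tsum_add ω.summable]
  ring

/-- The terms `⌊x - rep e⌋ + 1` and `⌈x - rep e⌉` count lifts of `e` up to `x`, with and without `x`
itself, so they differ only if `x` lifts `e`. -/
lemma right_eq (x : ℝ) : ω.right x = ω.left x + ω.w x := by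
  have h : ∑' e, (ω.w e * (⌊x - rep e⌋ + 1 : ℝ) - ω.w e * ⌈x - rep e⌉) = ω.w x := by
    rw [tsum_eq_single (x : S1)]
    · obtain ⟨k, hk⟩ : ∃ k : ℤ, x - rep x = k := by
        have : ((x - rep x : ℝ) : S1) = 0 := by
          rw [AddCircle.coe_sub, coe_rep, sub_self]
        obtain ⟨k, hk⟩ := (AddCircle.coe_eq_zero_iff (1 : ℝ)).1 this
        exact ⟨k, by simpa using hk.symm⟩
      rw [hk, Int.floor_intCast, Int.ceil_intCast]
      ring
    · intro e he
      have hne : ∀ k : ℤ, x - rep e ≠ k := by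
        intro k hk
        refine he ?_
        rw [← coe_rep e, eq_comm, ← sub_eq_zero, ← AddCircle.coe_sub, hk,
          AddCircle.coe_eq_zero_iff]
        exact ⟨k, by simp⟩
      have : ⌈x - rep e⌉ = ⌊x - rep e⌋ + 1 := by
        rw [Int.ceil_eq_iff]
        push_cast
        refine ⟨?_, (Int.lt_floor_add_one _).le⟩
        have := lt_of_le_of_ne (Int.floor_le (x - rep e)) (hne _).symm
        linarith
      rw [this]
      push_cast
      ring
  rw [(ω.summable_floor x).tsum_sub (ω.summable_ceil x)] at h
  simp only [right, left]
  linarith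

lemma left_le_right (x : ℝ) : ω.left x ≤ ω.right x := by
  rw [right_eq]
  linarith [ω.nonneg x]

lemma right_lt_left {x y : ℝ} (h : x < y) : ω.right x < ω.left y := by
  have h1 : ∑' e, ω.w e * (⌊x - rep e⌋ + 1 : ℝ) ≤ ∑' e, ω.w e * (⌈y - rep e⌉ : ℝ) := by
    refine (ω.summable_floor x).tsum_le_tsum (fun e => ?_) (ω.summable_ceil y)
    refine mul_le_mul_of_nonneg_left ?_ (ω.nonneg e)
    have : ⌊x - rep e⌋ < ⌈y - rep e⌉ := by
      rw [Int.lt_ceil]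
      linarith [Int.floor_le (x - rep e)]
    exact_mod_cast this
  have h2 : (1 - ∑' e, ω.w e) * x < (1 - ∑' e, ω.w e) * y :=
    mul_lt_mul_of_pos_left h (by linarith [ω.tsum_lt_one])
  simp only [right, left]
  linarith

lemma left_strictMono : StrictMono ω.left :=
  fun _ _ h => (ω.left_le_right _).trans_lt (ω.right_lt_left h)

/-- Each ceiling is eventually constant to the left of `x`; dominated convergence passes to the sum.
-/
lemma tendsto_left (x : ℝ) : Tendsto ω.left (𝓝[<] x) (𝓝 (ω.left x)) := by
  have hx : Tendsto (fun y : ℝ => y) (𝓝[<] x) (𝓝 x) := nhdsWithin_le_nhds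
  refine (hx.const_mul _).add ?_
  refine tendsto_tsum_of_dominated_convergence (bound := fun e => ω.w e * (|x| + 3))
    (ω.summable.mul_right _) (fun e => ?_) ?_
  · refine tendsto_const_nhds.congr' ?_
    have : Ioo (⌈x - rep e⌉ - 1 + rep e) x ∈ 𝓝[<] x := Ioo_mem_nhdsLT (by
      linarith [Int.ceil_lt_add_one (x - rep e)])
    filter_upwards [this] with y hy
    congr 2
    rw [eq_comm, Int.ceil_eq_iff]
    exact ⟨by linarith [hy.1], by linarith [hy.2, Int.le_ceil (x - rep e)]⟩
  · have : Ioo (x - 1) x ∈ 𝓝[<] x := Ioo_mem_nhdsLT (by linarith)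
    filter_upwards [this] with y hy e
    refine ω.norm_mul_le e ((abs_ceil_le y e).trans ?_)
    have : |y| ≤ |x| + 1 := by
      rw [abs_le]
      constructor <;> linarith [neg_abs_le x, le_abs_self x, hy.1, hy.2]
    linarith

lemma tendsto_right (x : ℝ) : Tendsto ω.right (𝓝[>] x) (𝓝 (ω.right x)) := by
  have hx : Tendsto (fun y : ℝ => y) (𝓝[>] x) (𝓝 x) := nhdsWithin_le_nhds
  refine (hx.const_mul _).add ?_
  refine tendsto_tsum_of_dominated_convergence (bound := fun e => ω.w e * (|x| + 3))
    (ω.summable.mul_right _) (fun e => ?_) ?_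
  · refine tendsto_const_nhds.congr' ?_
    have : Ioo x (⌊x - rep e⌋ + 1 + rep e) ∈ 𝓝[>] x := Ioo_mem_nhdsGT (by
      linarith [Int.lt_floor_add_one (x - rep e)])
    filter_upwards [this] with y hy
    congr 3
    rw [eq_comm, Int.floor_eq_iff]
    exact ⟨by linarith [hy.1, Int.floor_le (x - rep e)], by linarith [hy.2]⟩
  · have : Ioo x (x + 1) ∈ 𝓝[>] x := Ioo_mem_nhdsGT (by linarith)
    filter_upwards [this] with y hy e
    refine ω.norm_mul_le e ((abs_floor_le y e).trans ?_)
    have : |y| ≤ |x| + 1 := by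
      rw [abs_le]
      constructor <;> linarith [neg_abs_le x, le_abs_self x, hy.1, hy.2]
    linarith

lemma left_add_natCast (x : ℝ) (k : ℕ) : ω.left (x + k) = ω.left x + k := by
  induction k with
  | zero => simp
  | succ k ih =>
    push_cast
    rw [← add_assoc, left_add_one, ih, add_assoc]

/-- No gap is left between the intervals: at the supremum of the points whose left end is at most
`t`, one-sided continuity gives both bounds. -/
lemma exists_collapse (t : ℝ) : ∃ x, ω.left x ≤ t ∧ t ≤ ω.right x := by
  let S : Set ℝ := {x | ω.left x ≤ t}
  have hne : S.Nonempty := by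
    obtain ⟨k, hk⟩ := exists_nat_ge (ω.left 0 - t)
    refine ⟨-k, ?_⟩
    have := ω.left_add_natCast (-k) k
    simp only [neg_add_cancel] at this
    change ω.left (-k) ≤ t
    linarith
  have hbdd : BddAbove S := by
    obtain ⟨k, hk⟩ := exists_nat_gt (t - ω.left 0)
    refine ⟨k, fun x (hx : ω.left x ≤ t) => ?_⟩
    have := ω.left_add_natCast 0 k
    rw [zero_add] at this
    by_contra! h
    linarith [ω.left_strictMono h]
  refine ⟨sSup S, ?_, ?_⟩
  · refine le_of_tendsto (ω.tendsto_left (sSup S)) ?_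
    filter_upwards [self_mem_nhdsWithin] with y hy
    obtain ⟨z, hz, hyz⟩ := exists_lt_of_lt_csSup hne hy
    exact (ω.left_strictMono hyz).le.trans hz
  · refine ge_of_tendsto (ω.tendsto_right (sSup S)) ?_
    filter_upwards [self_mem_nhdsWithin] with y hy
    by_contra! h
    exact absurd (le_csSup hbdd (show y ∈ S from (ω.left_le_right y).trans h.le)) (not_le.2 hy)

/-- The monotone map collapsing the inserted intervals. -/
def collapse (t : ℝ) : ℝ := (ω.exists_collapse t).choose

lemma left_collapse_le (t : ℝ) : ω.left (ω.collapse t) ≤ t := (ω.exists_collapse t).choose_spec.1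

lemma le_right_collapse (t : ℝ) : t ≤ ω.right (ω.collapse t) :=
  (ω.exists_collapse t).choose_spec.2

lemma collapse_lt_imp {t t' : ℝ} (h : ω.collapse t < ω.collapse t') : t < t' :=
  (ω.le_right_collapse t).trans_lt ((ω.right_lt_left h).trans_le (ω.left_collapse_le t'))

lemma collapse_eq {t x : ℝ} (h1 : ω.left x ≤ t) (h2 : t ≤ ω.right x) : ω.collapse t = x := by
  rcases lt_trichotomy (ω.collapse t) x with h | h | h
  · linarith [ω.right_lt_left h, ω.le_right_collapse t]
  · exact h
  · linarith [ω.right_lt_left h, ω.left_collapse_le t]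

@[simp] lemma collapse_left (x : ℝ) : ω.collapse (ω.left x) = x :=
  ω.collapse_eq le_rfl (ω.left_le_right x)

@[simp] lemma collapse_right (x : ℝ) : ω.collapse (ω.right x) = x :=
  ω.collapse_eq (ω.left_le_right x) le_rfl

lemma monotone_collapse : Monotone ω.collapse := by
  intro t t' h
  by_contra! h'
  exact absurd (ω.collapse_lt_imp h') (not_lt.2 h)

lemma right_add_one (x : ℝ) : ω.right (x + 1) = ω.right x + 1 := by
  rw [right_eq, right_eq, left_add_one, AddCircle.coe_add_period]
  ring

lemma collapse_add_one (t : ℝ) : ω.collapse (t + 1) = ω.collapse t + 1 := by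
  refine ω.collapse_eq ?_ ?_
  · rw [left_add_one]
    linarith [ω.left_collapse_le t]
  · rw [right_add_one]
    linarith [ω.le_right_collapse t]

/-- The relative position of `t` in the interval containing it. -/
def pos (t : ℝ) : ℝ := (t - ω.left (ω.collapse t)) / ω.w (ω.collapse t)

lemma pos_nonneg (t : ℝ) : 0 ≤ ω.pos t :=
  div_nonneg (by linarith [ω.left_collapse_le t]) (ω.nonneg _)

lemma pos_le_one (t : ℝ) : ω.pos t ≤ 1 := by
  refine div_le_one_of_le₀ ?_ (ω.nonneg _)
  have := ω.le_right_collapse t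
  rw [right_eq] at this
  linarith

/-- On a degenerate interval `pos` is a division by zero, but it is multiplied by a zero weight. -/
lemma eq_left_add (t : ℝ) : t = ω.left (ω.collapse t) + ω.pos t * ω.w (ω.collapse t) := by
  by_cases h : ω.w (ω.collapse t) = 0
  · have h1 := ω.left_collapse_le t
    have h2 := ω.le_right_collapse t
    rw [right_eq, h] at h2
    rw [h]
    linarith
  · rw [pos, div_mul_cancel₀ _ h]
    ring

/-- The lift of the homeomorphism covering the translation by `ρ`, affine on inserted intervals. -/
def lift (ρ t : ℝ) : ℝ := ω.left (ω.collapse t + ρ) + ω.pos t * ω.w ((ω.collapse t + ρ : ℝ) : S1)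

lemma left_le_lift (ρ t : ℝ) : ω.left (ω.collapse t + ρ) ≤ ω.lift ρ t := by
  have := mul_nonneg (ω.pos_nonneg t) (ω.nonneg ((ω.collapse t + ρ : ℝ) : S1))
  rw [lift]
  linarith

lemma lift_le_right (ρ t : ℝ) : ω.lift ρ t ≤ ω.right (ω.collapse t + ρ) := by
  have := mul_le_mul_of_nonneg_right (ω.pos_le_one t) (ω.nonneg ((ω.collapse t + ρ : ℝ) : S1))
  rw [lift, right_eq]
  linarith

@[simp] lemma collapse_lift (ρ t : ℝ) : ω.collapse (ω.lift ρ t) = ω.collapse t + ρ :=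
  ω.collapse_eq (ω.left_le_lift ρ t) (ω.lift_le_right ρ t)

lemma pos_lift {ρ t : ℝ} (h : ω.w ((ω.collapse t + ρ : ℝ) : S1) ≠ 0) :
    ω.pos (ω.lift ρ t) = ω.pos t := by
  conv_lhs => rw [pos, collapse_lift, lift, add_sub_cancel_left]
  exact mul_div_cancel_right₀ _ h

/-- The hypothesis `hρ` says that no genuine interval is squeezed to a point, so the relative
position can be recovered. -/
lemma lift_lift {ρ ξ : ℝ} (hρ : ∀ x : ℝ, ω.w ((x + ρ : ℝ) : S1) = 0 → ω.w x = 0)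
    (h : ρ + ξ = 0) (t : ℝ) : ω.lift ξ (ω.lift ρ t) = t := by
  have h0 : ω.collapse t + ρ + ξ = ω.collapse t := by rw [add_assoc, h, add_zero]
  conv_rhs => rw [ω.eq_left_add t]
  conv_lhs => rw [lift, collapse_lift, h0]
  by_cases hw : ω.w (ω.collapse t) = 0
  · simp [hw]
  · rw [ω.pos_lift fun h' => hw (hρ _ h')]

lemma monotone_lift (ρ : ℝ) : Monotone (ω.lift ρ) := by
  intro t t' h
  rcases (ω.monotone_collapse h).lt_or_eq with h' | h'
  · exact (ω.lift_le_right ρ t).trans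
      ((ω.right_lt_left (by linarith)).le.trans (ω.left_le_lift ρ t'))
  · have : ω.pos t ≤ ω.pos t' := by
      rw [pos, pos, h']
      exact div_le_div_of_nonneg_right (by linarith) (ω.nonneg _)
    rw [lift, lift, h']
    have := mul_le_mul_of_nonneg_right this (ω.nonneg ((ω.collapse t' + ρ : ℝ) : S1))
    linarith

lemma lift_add_one (ρ t : ℝ) : ω.lift ρ (t + 1) = ω.lift ρ t + 1 := by
  have hp : ω.pos (t + 1) = ω.pos t := by
    rw [pos, pos, collapse_add_one, left_add_one, AddCircle.coe_add_period]
    congr 1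
    ring
  rw [lift, lift, hp, collapse_add_one, add_right_comm, left_add_one, AddCircle.coe_add_period]
  ring

lemma lift_left (ρ x : ℝ) : ω.lift ρ (ω.left x) = ω.left (x + ρ) := by
  simp [lift, pos]

lemma lift_right {ρ x : ℝ} (h : ω.w x = 0 → ω.w ((x + ρ : ℝ) : S1) = 0) :
    ω.lift ρ (ω.right x) = ω.right (x + ρ) := by
  by_cases hw : ω.w x = 0
  · rw [right_eq, right_eq, hw, h hw, add_zero, add_zero, lift_left]
  · rw [lift, pos, collapse_right, right_eq, add_sub_cancel_left, div_self hw, one_mul, right_eq]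

/-- The left and right ends of the inserted intervals, and the points which are not blown up. -/
def core : Set ℝ := {t | t = ω.left (ω.collapse t) ∨ t = ω.right (ω.collapse t)}

lemma isClosed_core : IsClosed ω.core := by
  rw [← isOpen_compl_iff, isOpen_iff_mem_nhds]
  intro t ht
  simp only [core, mem_compl_iff, mem_ofPred_eq, not_or] at ht
  have h1 := lt_of_le_of_ne (ω.left_collapse_le t) (Ne.symm ht.1)
  have h2 := lt_of_le_of_ne (ω.le_right_collapse t) ht.2
  filter_upwards [Ioo_mem_nhds h1 h2] with s hs
  have hc := ω.collapse_eq hs.1.le hs.2.le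
  simp only [core, mem_compl_iff, mem_ofPred_eq, not_or, hc]
  exact ⟨hs.1.ne', hs.2.ne⟩

lemma add_one_mem_core {t : ℝ} : t + 1 ∈ ω.core ↔ t ∈ ω.core := by
  simp only [core, mem_ofPred_eq, collapse_add_one, left_add_one, right_add_one, add_left_inj]

end Weight

lemma exists_weight {E : Set S1} (hE : E.Countable) :
    ∃ ω : Weight, ∀ e, ω.w e = 0 ↔ e ∉ E := by
  -- Any total below one would do.
  obtain ⟨δ, hδ, c, hc, hc1⟩ := hE.exists_pos_hasSum_le (ε := 1 / 2) (by norm_num)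
  have hs : HasSum (E.indicator δ) c := hasSum_subtype_iff_indicator.1 hc
  refine ⟨⟨E.indicator δ, fun e => indicator_nonneg (fun _ _ => (hδ _).le) e, hs.summable, ?_⟩,
    fun e => ?_⟩
  · rw [hs.tsum_eq]
    linarith
  · simp [indicator_apply_eq_zero, (hδ e).ne']

/-! ### Circle homeomorphisms from lifts -/

lemma coe_periodic {f : ℝ → ℝ} (hf : ∀ t, f (t + 1) = f t + 1) :
    Function.Periodic (fun t => (f t : S1)) 1 := fun t => by
  simp only [hf, AddCircle.coe_add_period]

lemma continuous_periodic_lift {Z : Type*} [TopologicalSpace Z] {f : ℝ → Z}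
    (hp : Function.Periodic f 1) (hf : Continuous f) : Continuous hp.lift :=
  (QuotientAddGroup.isQuotientMap_mk (AddSubgroup.zmultiples (1 : ℝ))).continuous_iff.2 hf

/-- The circle homeomorphism with lift `f` and inverse lift `g`. -/
def circleHomeo (f g : ℝ → ℝ) (hf : ∀ t, f (t + 1) = f t + 1) (hg : ∀ t, g (t + 1) = g t + 1)
    (hfc : Continuous f) (hgc : Continuous g) (hgf : ∀ t, g (f t) = t) (hfg : ∀ t, f (g t) = t) :
    S1 ≃ₜ S1 where
  toFun := (coe_periodic hf).lift
  invFun := (coe_periodic hg).lift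
  left_inv x := by
    obtain ⟨t, rfl⟩ := QuotientAddGroup.mk_surjective x
    change (coe_periodic hg).lift (f t : S1) = (t : S1)
    rw [Function.Periodic.lift_coe, hgf]
  right_inv x := by
    obtain ⟨t, rfl⟩ := QuotientAddGroup.mk_surjective x
    change (coe_periodic hf).lift (g t : S1) = (t : S1)
    rw [Function.Periodic.lift_coe, hfg]
  continuous_toFun := continuous_periodic_lift _ ((AddCircle.continuous_mk' 1).comp hfc)
  continuous_invFun := continuous_periodic_lift _ ((AddCircle.continuous_mk' 1).comp hgc)

namespace Weight

variable (ω : Weight) {ρ : ℝ} (h : ∀ e : S1, ω.w (e + (ρ : S1)) = 0 ↔ ω.w e = 0)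

include h in
lemma lift_neg_lift (t : ℝ) : ω.lift (-ρ) (ω.lift ρ t) = t :=
  ω.lift_lift (fun x hx => (h x).1 hx) (add_neg_cancel ρ) t

include h in
lemma lift_lift_neg (t : ℝ) : ω.lift ρ (ω.lift (-ρ) t) = t := by
  refine ω.lift_lift (fun x hx => ?_) (neg_add_cancel ρ) t
  have := (h ((x + -ρ : ℝ) : S1)).2 hx
  rwa [← AddCircle.coe_add, neg_add_cancel_right] at this

include h in
-- A monotone surjection of the line is continuous, so no estimate on the intervals is needed.
lemma continuous_lift : Continuous (ω.lift ρ) :=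
  (ω.monotone_lift ρ).continuous_of_surjective fun t => ⟨_, ω.lift_lift_neg h t⟩

include h in
lemma continuous_lift_neg : Continuous (ω.lift (-ρ)) :=
  (ω.monotone_lift (-ρ)).continuous_of_surjective fun t => ⟨_, ω.lift_neg_lift h t⟩

/-- The circle homeomorphism obtained by blowing up the support of the weight. -/
def homeo : S1 ≃ₜ S1 := circleHomeo (ω.lift ρ) (ω.lift (-ρ)) (ω.lift_add_one ρ)
  (ω.lift_add_one (-ρ)) (ω.continuous_lift h) (ω.continuous_lift_neg h) (ω.lift_neg_lift h)
  (ω.lift_lift_neg h)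

lemma homeo_coe (t : ℝ) : ω.homeo h (t : S1) = (ω.lift ρ t : S1) := rfl

/-- The lift as a degree one monotone map. -/
def deg1Lift (ρ : ℝ) : CircleDeg1Lift where
  toFun := ω.lift ρ
  monotone' := ω.monotone_lift ρ
  map_add_one' := ω.lift_add_one ρ

/-- The collapsing map as a degree one monotone map. -/
def deg1Collapse : CircleDeg1Lift where
  toFun := ω.collapse
  monotone' := ω.monotone_collapse
  map_add_one' := ω.collapse_add_one

/-- The collapsing map semiconjugates the lift to a translation; it need not be continuous for this.
-/
lemma translationNumber_deg1Lift : (ω.deg1Lift ρ).translationNumber = ρ := by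
  rw [CircleDeg1Lift.translationNumber_eq_of_semiconj (f := ω.deg1Collapse)
    (g₂ := CircleDeg1Lift.translate (Multiplicative.ofAdd ρ)) (fun t => ?_),
    CircleDeg1Lift.translationNumber_translate]
  rw [CircleDeg1Lift.translate_apply, add_comm ρ]
  exact ω.collapse_lift ρ t

/-- The circle points all of whose lifts are in the core. -/
def circleCore : Set S1 := {y | ∃ t ∈ ω.core, (t : S1) = y}

lemma core_add_intCast {t : ℝ} (k : ℤ) : t + k ∈ ω.core ↔ t ∈ ω.core := by
  induction k with
  | zero => simp
  | succ k ih =>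
    push_cast at ih ⊢
    rw [← add_assoc, add_one_mem_core, ih]
  | pred k ih =>
    push_cast at ih ⊢
    rw [← ih, ← add_one_mem_core]
    ring_nf

lemma coe_mem_circleCore {t : ℝ} : (t : S1) ∈ ω.circleCore ↔ t ∈ ω.core := by
  refine ⟨?_, fun ht => ⟨t, ht, rfl⟩⟩
  rintro ⟨s, hs, hst⟩
  rw [← sub_eq_zero, ← AddCircle.coe_sub, AddCircle.coe_eq_zero_iff] at hst
  obtain ⟨k, hk⟩ := hst
  rw [← ω.core_add_intCast k]
  convert hs
  simp only [zsmul_eq_mul, mul_one] at hk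
  linarith

lemma isClosed_circleCore : IsClosed ω.circleCore := by
  rw [← (QuotientAddGroup.isQuotientMap_mk (G := ℝ)
    (N := AddSubgroup.zmultiples (1 : ℝ))).isClosed_preimage]
  convert ω.isClosed_core
  ext t
  exact ω.coe_mem_circleCore

include h in
lemma lift_mem_core {t : ℝ} (ht : t ∈ ω.core) : ω.lift ρ t ∈ ω.core := by
  rcases ht with ht | ht
  · left
    rw [collapse_lift]
    conv_lhs => rw [ht, lift_left]
  · right
    rw [collapse_lift]
    conv_lhs => rw [ht]
    exact ω.lift_right fun hw => (h _).2 hw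

include h in
lemma lift_neg_mem_core {t : ℝ} (ht : t ∈ ω.core) : ω.lift (-ρ) t ∈ ω.core := by
  have h' : ∀ e : S1, ω.w (e + ((-ρ : ℝ) : S1)) = 0 ↔ ω.w e = 0 := fun e => by
    rw [← h, AddCircle.coe_neg, neg_add_cancel_right]
  exact ω.lift_mem_core h' ht

lemma image_homeo_circleCore : ω.homeo h '' ω.circleCore = ω.circleCore := by
  ext y
  constructor
  · rintro ⟨_, ⟨t, ht, rfl⟩, rfl⟩
    exact ω.coe_mem_circleCore.2 (ω.lift_mem_core h ht)
  · rintro ⟨t, ht, rfl⟩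
    refine ⟨_, ω.coe_mem_circleCore.2 (ω.lift_neg_mem_core h ht), ?_⟩
    rw [homeo_coe, ω.lift_lift_neg h]

lemma circleCore_ne_univ {e : S1} (he : ω.w e ≠ 0) : ω.circleCore ≠ univ := by
  obtain ⟨x, rfl⟩ := QuotientAddGroup.mk_surjective e
  have hpos : 0 < ω.w (x : S1) := lt_of_le_of_ne (ω.nonneg _) (Ne.symm he)
  intro hu
  have hm : ω.left x + ω.w (x : S1) / 2 ∈ ω.core := by
    rw [← coe_mem_circleCore, hu]
    trivial
  have hc : ω.collapse (ω.left x + ω.w (x : S1) / 2) = x :=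
    ω.collapse_eq (by linarith) (by rw [right_eq]; linarith)
  rcases hm with hm | hm <;> rw [hc] at hm
  · linarith
  · rw [right_eq] at hm
    linarith

end Weight

lemma zpow_mem_of_image_eq {X : Type*} [TopologicalSpace X] {g : X ≃ₜ X} {K : Set X}
    (hK : g '' K = K) (i : ℤ) {x : X} (hx : x ∈ K) : (g ^ i) x ∈ K := by
  have h1 : ∀ x ∈ K, g x ∈ K := fun x hx => hK.subset (mem_image_of_mem _ hx)
  have h2 : ∀ x ∈ K, g⁻¹ x ∈ K := fun x hx => by
    obtain ⟨y, hy, rfl⟩ := hK.superset hx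
    change g.symm (g y) ∈ K
    rwa [Homeomorph.symm_apply_apply]
  induction i with
  | zero => simpa
  | succ i ih =>
    rw [add_comm, zpow_one_add, Homeomorph.mul_apply]
    exact h1 _ ih
  | pred i ih =>
    rw [sub_eq_neg_add, zpow_add, Homeomorph.mul_apply, zpow_neg_one]
    exact h2 _ ih

/-- Minimality can be transported backwards along an injective continuous equivariant map. -/
lemma IsMinimalSet.of_injOn {X Z : Type*} [TopologicalSpace X] [TopologicalSpace Z] [T2Space Z]
    [T2Space X] {g : X ≃ₜ X} {h : Z ≃ₜ Z} {K : Set X} {Y : Set Z} (hK : IsCompact K)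
    (hgK : g '' K = K) {κ : X → Z} (hκ : ContinuousOn κ K) (hi : InjOn κ K) (hY : κ '' K = Y)
    (heq : ∀ x ∈ K, κ (g x) = h (κ x)) (hmin : IsMinimalSet h Y) : IsMinimalSet g K where
  isCompact := hK
  nonempty := by
    obtain ⟨y, hy⟩ := hmin.nonempty
    obtain ⟨x, hx, -⟩ := hY.superset hy
    exact ⟨x, hx⟩
  invariant := hgK
  dense_orbit := by
    intro x hx y hy
    have hmem : ∀ i : ℤ, (g ^ i) x ∈ K := fun i => zpow_mem_of_image_eq hgK i hx
    have horb : ∀ i : ℤ, κ ((g ^ i) x) = (h ^ i) (κ x) := by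
      have h1 : ∀ i : ℤ, κ ((g ^ (i + 1)) x) = h (κ ((g ^ i) x)) := fun i => by
        rw [add_comm, zpow_one_add, Homeomorph.mul_apply, heq _ (hmem i)]
      have h2 : ∀ i : ℤ, (h ^ (i + 1)) (κ x) = h ((h ^ i) (κ x)) := fun i => by
        rw [add_comm, zpow_one_add, Homeomorph.mul_apply]
      intro i
      induction i with
      | zero => simp
      | succ i ih => rw [h1, h2, ih]
      | pred i ih =>
        apply h.injective
        rw [← h1, ← h2, sub_add_cancel, ih]
    have hsub : closure (orbit g x) ⊆ K := by
      refine closure_minimal ?_ hK.isClosed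
      rintro _ ⟨i, rfl⟩
      exact hmem i
    have hcomp : IsCompact (κ '' closure (orbit g x)) :=
      (hK.of_isClosed_subset isClosed_closure hsub).image_of_continuousOn (hκ.mono hsub)
    have hin : closure (orbit h (κ x)) ⊆ κ '' closure (orbit g x) := by
      refine closure_minimal ?_ hcomp.isClosed
      rintro _ ⟨i, rfl⟩
      exact ⟨_, subset_closure ⟨i, rfl⟩, horb i⟩
    obtain ⟨z, hz, hzy⟩ := hin (hmin.dense_orbit _ (hY.subset (mem_image_of_mem _ hx))
      (hY.subset (mem_image_of_mem _ hy)))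
    rwa [← hi (hsub hz) hy hzy]

lemma AreConjugate.of_injOn {X Z : Type*} [TopologicalSpace X] [TopologicalSpace Z] [T2Space Z]
    {g : X ≃ₜ X} {h : Z ≃ₜ Z} {K : Set X} {Y : Set Z} (hK : IsCompact K)
    (hgK : g '' K = K) {κ : X → Z} (hκ : ContinuousOn κ K) (hi : InjOn κ K) (hY : κ '' K = Y)
    (heq : ∀ x ∈ K, κ (g x) = h (κ x)) (hhY : h '' Y = Y) : AreConjugate h Y g K := by
  have : CompactSpace K := isCompact_iff_compactSpace.1 hK
  have hm : MapsTo κ K Y := fun x hx => hY.subset (mem_image_of_mem _ hx)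
  let f : K ≃ Y := Equiv.ofBijective (hm.restrict κ K Y)
    ⟨hm.restrict_inj.2 hi, (MapsTo.restrict_surjective_iff hm).2 hY.superset⟩
  have hf : Continuous f := hκ.mapsToRestrict hm
  let e : K ≃ₜ Y := hf.homeoOfEquivCompactToT2
  refine ⟨hhY, hgK, e.symm, fun y hy => ?_⟩
  obtain ⟨x, rfl⟩ := e.surjective y
  have hgx : g x ∈ K := hgK.subset (mem_image_of_mem _ x.2)
  have : (⟨h (e x), hy⟩ : Y) = e ⟨g x, hgx⟩ := Subtype.ext (heq x x.2).symm
  rw [this, e.symm_apply_apply, e.symm_apply_apply]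

/-! ### One-sided symbols -/

section OneSided

variable {U : RO} (hU : (frontier U.carrier).Finite)
include hU

lemma eventually_notMem_frontier (x : ℝ) : ∀ᶠ z : ℝ in 𝓝[≠] x, (z : S1) ∉ frontier U.carrier := by
  have h1 : ∀ᶠ y in 𝓝[≠] (x : S1), y ∉ frontier U.carrier := by
    have : (frontier U.carrier \ {(x : S1)})ᶜ ∈ 𝓝 (x : S1) :=
      hU.sdiff.isClosed.isOpen_compl.mem_nhds (by simp)
    rw [eventually_nhdsWithin_iff]
    filter_upwards [this] with y hy hne hfr
    exact hy ⟨hfr, hne⟩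
  have h2 : Tendsto (fun z : ℝ => (z : S1)) (𝓝[≠] x) (𝓝[≠] (x : S1)) := by
    refine tendsto_nhdsWithin_iff.2
      ⟨((AddCircle.continuous_mk' 1).tendsto x).mono_left nhdsWithin_le_nhds, ?_⟩
    -- Within distance one of `x` there is no other lift of the same circle point.
    have : Ioo (x - 1) (x + 1) ∈ 𝓝 x := Ioo_mem_nhds (by linarith) (by linarith)
    filter_upwards [self_mem_nhdsWithin, nhdsWithin_le_nhds this] with z hz hz'
    intro (heq : (z : S1) = (x : S1))
    rw [← sub_eq_zero, ← AddCircle.coe_sub, AddCircle.coe_eq_zero_iff] at heq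
    obtain ⟨k, hk⟩ := heq
    simp only [zsmul_eq_mul, mul_one] at hk
    have h1 : (k : ℝ) < 1 := by linarith [hz'.2]
    have h2 : (-1 : ℝ) < k := by linarith [hz'.1]
    have hk0 : k = 0 := by
      have h1' : k < 1 := by exact_mod_cast h1
      have h2' : -1 < k := by exact_mod_cast h2
      omega
    rw [hk0] at hk
    exact hz (by simp only [mem_singleton_iff]; push_cast at hk; linarith)
  exact h2.eventually h1

omit hU in
lemma exists_symbol_of_isPreconnected {I : Set ℝ} (hI : IsPreconnected I)
    (h : ∀ z ∈ I, (z : S1) ∉ frontier U.carrier) : ∃ e, ∀ z ∈ I, (z : S1) ∈ U.side e := by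
  have ho : ∀ e, IsOpen ((fun z : ℝ => (z : S1)) ⁻¹' U.side e) := fun e =>
    (U.isOpen_side e).preimage (AddCircle.continuous_mk' 1)
  have hd : Disjoint ((fun z : ℝ => (z : S1)) ⁻¹' U.side 0)
      ((fun z : ℝ => (z : S1)) ⁻¹' U.side 1) := by
    rw [disjoint_left]
    intro z h0 h1
    have : (0 : Fin 2) = 1 := U.side_unique h0 h1
    exact absurd this (by decide)
  have hc : I ⊆ ((fun z : ℝ => (z : S1)) ⁻¹' U.side 0) ∪ ((fun z : ℝ => (z : S1)) ⁻¹' U.side 1) := by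
    intro z hz
    obtain ⟨e, he⟩ := U.notMem_frontier_iff.1 (h z hz)
    fin_cases e
    exacts [Or.inl he, Or.inr he]
  rcases hI.subset_or_subset (ho 0) (ho 1) hd hc with h | h
  exacts [⟨0, h⟩, ⟨1, h⟩]

lemma exists_leftSymbol (x : ℝ) : ∃ e, ∀ᶠ z : ℝ in 𝓝[<] x, (z : S1) ∈ U.side e := by
  have h := (eventually_notMem_frontier hU x).filter_mono
    (nhdsWithin_mono x (fun z (hz : z < x) => hz.ne))
  obtain ⟨l, hl, hlx⟩ := (mem_nhdsLT_iff_exists_Ioo_subset).1 h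
  obtain ⟨e, he⟩ := exists_symbol_of_isPreconnected isPreconnected_Ioo hlx
  exact ⟨e, mem_of_superset (Ioo_mem_nhdsLT hl) he⟩

lemma exists_rightSymbol (x : ℝ) : ∃ e, ∀ᶠ z : ℝ in 𝓝[>] x, (z : S1) ∈ U.side e := by
  have h := (eventually_notMem_frontier hU x).filter_mono
    (nhdsWithin_mono x (fun z (hz : x < z) => hz.ne'))
  obtain ⟨l, hl, hlx⟩ := (mem_nhdsGT_iff_exists_Ioo_subset).1 h
  obtain ⟨e, he⟩ := exists_symbol_of_isPreconnected isPreconnected_Ioo hlx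
  exact ⟨e, mem_of_superset (Ioo_mem_nhdsGT hl) he⟩

/-- The side of `U` immediately to the left of `x`. -/
def leftSymbol (x : ℝ) : Fin 2 := (exists_leftSymbol hU x).choose

/-- The side of `U` immediately to the right of `x`. -/
def rightSymbol (x : ℝ) : Fin 2 := (exists_rightSymbol hU x).choose

lemma eventually_leftSymbol (x : ℝ) : ∀ᶠ z : ℝ in 𝓝[<] x, (z : S1) ∈ U.side (leftSymbol hU x) :=
  (exists_leftSymbol hU x).choose_spec

lemma eventually_rightSymbol (x : ℝ) : ∀ᶠ z : ℝ in 𝓝[>] x, (z : S1) ∈ U.side (rightSymbol hU x) :=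
  (exists_rightSymbol hU x).choose_spec

lemma leftSymbol_eq {x : ℝ} {e : Fin 2} (h : ∀ᶠ z : ℝ in 𝓝[<] x, (z : S1) ∈ U.side e) :
    leftSymbol hU x = e := by
  obtain ⟨z, hz⟩ := (h.and (eventually_leftSymbol hU x)).exists
  exact U.side_unique hz.2 hz.1

lemma rightSymbol_eq {x : ℝ} {e : Fin 2} (h : ∀ᶠ z : ℝ in 𝓝[>] x, (z : S1) ∈ U.side e) :
    rightSymbol hU x = e := by
  obtain ⟨z, hz⟩ := (h.and (eventually_rightSymbol hU x)).exists
  exact U.side_unique hz.2 hz.1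

omit hU in
lemma eventually_mem_side {x : ℝ} {e : Fin 2} (h : (x : S1) ∈ U.side e) :
    ∀ᶠ z : ℝ in 𝓝 x, (z : S1) ∈ U.side e :=
  ((U.isOpen_side e).preimage (AddCircle.continuous_mk' 1)).mem_nhds h

lemma leftSymbol_of_mem {x : ℝ} {e : Fin 2} (h : (x : S1) ∈ U.side e) : leftSymbol hU x = e :=
  leftSymbol_eq hU ((eventually_mem_side h).filter_mono nhdsWithin_le_nhds)

lemma rightSymbol_of_mem {x : ℝ} {e : Fin 2} (h : (x : S1) ∈ U.side e) : rightSymbol hU x = e :=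
  rightSymbol_eq hU ((eventually_mem_side h).filter_mono nhdsWithin_le_nhds)

lemma mem_closure_leftSymbol (x : ℝ) : (x : S1) ∈ closure (U.side (leftSymbol hU x)) :=
  mem_closure_of_tendsto (f := fun z : ℝ => (z : S1)) (((AddCircle.continuous_mk' 1).tendsto x).mono_left nhdsWithin_le_nhds)
    (eventually_leftSymbol hU x)

lemma mem_closure_rightSymbol (x : ℝ) : (x : S1) ∈ closure (U.side (rightSymbol hU x)) :=
  mem_closure_of_tendsto (f := fun z : ℝ => (z : S1)) (((AddCircle.continuous_mk' 1).tendsto x).mono_left nhdsWithin_le_nhds)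
    (eventually_rightSymbol hU x)

/-- If the symbols agreed, a neighbourhood of `x` would lie in the closure of one side, so by
regularity `x` would lie in that side. -/
lemma leftSymbol_ne_rightSymbol {x : ℝ} (hx : (x : S1) ∈ frontier U.carrier) :
    leftSymbol hU x ≠ rightSymbol hU x := by
  intro h
  refine (not_not.2 hx) (U.notMem_frontier_iff.2 ⟨leftSymbol hU x, ?_⟩)
  rw [← U.interior_closure_side, mem_interior_iff_mem_nhds,
    ← (QuotientAddGroup.isOpenQuotientMap_mk (N := AddSubgroup.zmultiples (1 : ℝ))).map_nhds_eq]
  have h1 := eventually_leftSymbol hU x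
  have h2 := eventually_rightSymbol hU x
  rw [← h, eventually_nhdsWithin_iff] at h2
  rw [eventually_nhdsWithin_iff] at h1
  rw [mem_map]
  filter_upwards [h1, h2] with z hz1 hz2
  rcases lt_trichotomy z x with hz | hz | hz
  · exact subset_closure (hz1 hz)
  · rw [hz]
    exact mem_closure_leftSymbol hU x
  · exact subset_closure (hz2 hz)

omit hU in
lemma tendsto_add_nhdsLT (x c : ℝ) : Tendsto (fun z => z + c) (𝓝[<] x) (𝓝[<] (x + c)) := by
  refine tendsto_nhdsWithin_iff.2
    ⟨((continuous_add_const c).tendsto x).mono_left nhdsWithin_le_nhds, ?_⟩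
  filter_upwards [self_mem_nhdsWithin] with z hz
  exact add_lt_add_left hz c

omit hU in
lemma tendsto_add_nhdsGT (x c : ℝ) : Tendsto (fun z => z + c) (𝓝[>] x) (𝓝[>] (x + c)) := by
  refine tendsto_nhdsWithin_iff.2
    ⟨((continuous_add_const c).tendsto x).mono_left nhdsWithin_le_nhds, ?_⟩
  filter_upwards [self_mem_nhdsWithin] with z hz
  exact add_lt_add_left hz c

lemma leftSymbol_add_one (x : ℝ) : leftSymbol hU (x + 1) = leftSymbol hU x := by
  refine (leftSymbol_eq hU ?_).symm
  filter_upwards [(tendsto_add_nhdsLT x 1).eventually (eventually_leftSymbol hU (x + 1))] with z hz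
  rwa [AddCircle.coe_add_period] at hz

lemma rightSymbol_add_one (x : ℝ) : rightSymbol hU (x + 1) = rightSymbol hU x := by
  refine (rightSymbol_eq hU ?_).symm
  filter_upwards [(tendsto_add_nhdsGT x 1).eventually (eventually_rightSymbol hU (x + 1))] with z hz
  rwa [AddCircle.coe_add_period] at hz

/-! ### The symbol of a point of the blown-up circle -/

variable (ω : Weight) (hω : ∀ e ∈ frontier U.carrier, ω.w e ≠ 0)

open Classical in
/-- The side of `U` on which a point of the core lies. -/
def coreSymbol (t : ℝ) : Fin 2 :=
  if t = ω.left (ω.collapse t) then leftSymbol hU (ω.collapse t)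
  else rightSymbol hU (ω.collapse t)

lemma coreSymbol_left (x : ℝ) : coreSymbol hU ω (ω.left x) = leftSymbol hU x := by
  simp [coreSymbol]

include hω in
-- The two ends coincide only off the frontier, where the one-sided symbols agree, so testing for
-- the left end first is harmless.
lemma coreSymbol_right (x : ℝ) : coreSymbol hU ω (ω.right x) = rightSymbol hU x := by
  by_cases h : ω.right x = ω.left x
  · have hx : (x : S1) ∉ frontier U.carrier := fun hx => hω _ hx (by
      rw [ω.right_eq] at h
      linarith)
    obtain ⟨e, he⟩ := U.notMem_frontier_iff.1 hx
    rw [h, coreSymbol_left, leftSymbol_of_mem hU he, rightSymbol_of_mem hU he]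
  · simp [coreSymbol, h]

lemma coreSymbol_of_mem {t : ℝ} {e : Fin 2} (h : (ω.collapse t : S1) ∈ U.side e) :
    coreSymbol hU ω t = e := by
  rw [coreSymbol]
  split_ifs
  exacts [leftSymbol_of_mem hU h, rightSymbol_of_mem hU h]

lemma coreSymbol_periodic : Function.Periodic (coreSymbol hU ω) 1 := by
  intro t
  simp only [coreSymbol, ω.collapse_add_one, ω.left_add_one, add_left_inj, leftSymbol_add_one,
    rightSymbol_add_one]

include hω in
-- Over a frontier point the inserted interval is nondegenerate and has no core point inside, so
-- core points near one end approach from that end's side. Elsewhere the sides are open.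
lemma eventually_coreSymbol_eq {t : ℝ} (ht : t ∈ ω.core) :
    ∀ᶠ s in 𝓝 t, s ∈ ω.core → coreSymbol hU ω s = coreSymbol hU ω t := by
  set x := ω.collapse t with hx
  have hlt : ∀ y < x, ω.right y < t := fun y hy =>
    (ω.right_lt_left hy).trans_le (ω.left_collapse_le t)
  have hgt : ∀ y > x, t < ω.left y := fun y hy =>
    (ω.le_right_collapse t).trans_lt (ω.right_lt_left hy)
  have hcl : ∀ {y s}, ω.right y < s → y < ω.collapse s := fun {y s} h => by
    by_contra! h'
    rcases h'.lt_or_eq with h' | h'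
    · linarith [ω.right_lt_left h', ω.le_right_collapse s, ω.left_le_right y]
    · linarith [h' ▸ ω.le_right_collapse s]
  have hcg : ∀ {y s}, s < ω.left y → ω.collapse s < y := fun {y s} h => by
    by_contra! h'
    rcases h'.lt_or_eq with h' | h'
    · linarith [ω.right_lt_left h', ω.left_collapse_le s, ω.left_le_right y]
    · linarith [h' ▸ ω.left_collapse_le s]
  by_cases hfr : (x : S1) ∈ frontier U.carrier
  · have hw : ω.left x < ω.right x := by
      rw [ω.right_eq]
      linarith [lt_of_le_of_ne (ω.nonneg _) (hω _ hfr).symm]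
    rcases ht with ht | ht <;> rw [← hx] at ht
    · obtain ⟨l, hl, hlx⟩ := (mem_nhdsLT_iff_exists_Ioo_subset).1 (eventually_leftSymbol hU x)
      filter_upwards [Ioo_mem_nhds (hlt l hl) (ht ▸ hw : t < ω.right x)] with s hs hsc
      have h1 := hcl hs.1
      rw [ht, coreSymbol_left]
      rcases lt_trichotomy (ω.collapse s) x with h | h | h
      · exact coreSymbol_of_mem hU ω (hlx ⟨h1, h⟩)
      · rcases hsc with hs' | hs' <;> rw [h] at hs'
        · rw [hs', coreSymbol_left]
        · exact absurd hs.2 (by rw [hs']; exact lt_irrefl _)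
      · linarith [hs.2, ω.right_lt_left h, ω.left_collapse_le s]
    · obtain ⟨l, hl, hlx⟩ := (mem_nhdsGT_iff_exists_Ioo_subset).1 (eventually_rightSymbol hU x)
      filter_upwards [Ioo_mem_nhds (ht ▸ hw : ω.left x < t) (hgt l hl)] with s hs hsc
      have h1 := hcg hs.2
      rw [ht, coreSymbol_right hU ω hω]
      rcases lt_trichotomy (ω.collapse s) x with h | h | h
      · linarith [hs.1, ω.right_lt_left h, ω.le_right_collapse s]
      · rcases hsc with hs' | hs' <;> rw [h] at hs'
        · exact absurd hs.1 (by rw [hs']; exact lt_irrefl _)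
        · rw [hs', coreSymbol_right hU ω hω]
      · exact coreSymbol_of_mem hU ω (hlx ⟨h, h1⟩)
  · obtain ⟨e, he⟩ := U.notMem_frontier_iff.1 hfr
    obtain ⟨l, u, hxlu, hlu⟩ := mem_nhds_iff_exists_Ioo_subset.1 (eventually_mem_side he)
    filter_upwards [Ioo_mem_nhds (hlt l hxlu.1) (hgt u hxlu.2)] with s hs _
    rw [coreSymbol_of_mem hU ω he, coreSymbol_of_mem hU ω (hlu ⟨hcl hs.1, hcg hs.2⟩)]

/-- The symbol of a point of the circle obtained by blowing up. -/
def circleSymbol : S1 → Fin 2 := (coreSymbol_periodic hU ω).lift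

lemma circleSymbol_coe (t : ℝ) : circleSymbol hU ω (t : S1) = coreSymbol hU ω t := rfl

include hω in
lemma continuousOn_circleSymbol : ContinuousOn (circleSymbol hU ω) ω.circleCore := by
  rintro _ ⟨t, ht, rfl⟩
  refine tendsto_nhds_of_eventually_eq ?_
  rw [eventually_nhdsWithin_iff,
    ← (QuotientAddGroup.isOpenQuotientMap_mk (N := AddSubgroup.zmultiples (1 : ℝ))).map_nhds_eq,
    eventually_map]
  filter_upwards [eventually_coreSymbol_eq hU ω hω ht] with s hs hsc
  exact hs (ω.coe_mem_circleCore.1 hsc)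

end OneSided

/-! ### Denjoy minimal sets -/

section Denjoy

variable {U : RO} (hU : (frontier U.carrier).Finite) {ρ : ℝ} (ω : Weight)
  (hω : ∀ e, ω.w e = 0 ↔ e ∈ goodSet U (ρ : S1))

lemma weight_invariant (hω : ∀ e, ω.w e = 0 ↔ e ∈ goodSet U (ρ : S1)) (e : S1) :
    ω.w (e + (ρ : S1)) = 0 ↔ ω.w e = 0 := by
  rw [hω, hω, mem_goodSet_add]

lemma weight_frontier (hω : ∀ e, ω.w e = 0 ↔ e ∈ goodSet U (ρ : S1)) (e : S1)
    (he : e ∈ frontier U.carrier) : ω.w e ≠ 0 := by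
  rw [Ne, hω, mem_goodSet]
  push Not
  exact ⟨0, by simpa⟩

/-- The itinerary of a point of the circle obtained by blowing up. -/
def circleItinerary (y : S1) : Sigma2 := fun i =>
  circleSymbol hU ω ((ω.homeo (weight_invariant ω hω) ^ i) y)

lemma circleItinerary_homeo (y : S1) :
    circleItinerary hU ω hω (ω.homeo (weight_invariant ω hω) y) =
      shift (circleItinerary hU ω hω y) := by
  funext i
  change circleSymbol hU ω _ = circleSymbol hU ω _
  rw [zpow_add_one, Homeomorph.mul_apply]

lemma continuousOn_circleItinerary : ContinuousOn (circleItinerary hU ω hω) ω.circleCore := by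
  rw [continuousOn_pi]
  intro i
  exact (continuousOn_circleSymbol hU ω (weight_frontier ω hω)).comp
    (Homeomorph.continuous _).continuousOn
    fun x hx => zpow_mem_of_image_eq (ω.image_homeo_circleCore _) i hx

lemma homeo_zpow_left (x : ℝ) (i : ℤ) :
    (ω.homeo (weight_invariant ω hω) ^ i) (ω.left x : S1) = (ω.left (x + i * ρ) : S1) := by
  have h1 : ∀ x, ω.homeo (weight_invariant ω hω) (ω.left x : S1) = (ω.left (x + ρ) : S1) :=
    fun x => by rw [ω.homeo_coe, ω.lift_left]
  induction i with
  | zero => simp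
  | succ i ih =>
    rw [add_comm, zpow_one_add, Homeomorph.mul_apply, ih, h1]
    push_cast
    ring_nf
  | pred i ih =>
    apply (ω.homeo (weight_invariant ω hω)).injective
    rw [← Homeomorph.mul_apply, ← zpow_one_add, add_sub_cancel, ih, h1]
    push_cast
    ring_nf

lemma homeo_zpow_right (x : ℝ) (i : ℤ) :
    (ω.homeo (weight_invariant ω hω) ^ i) (ω.right x : S1) = (ω.right (x + i * ρ) : S1) := by
  have h1 : ∀ x, ω.homeo (weight_invariant ω hω) (ω.right x : S1) = (ω.right (x + ρ) : S1) :=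
    fun x => by rw [ω.homeo_coe, ω.lift_right fun hw => (weight_invariant ω hω x).2 hw]
  induction i with
  | zero => simp
  | succ i ih =>
    rw [add_comm, zpow_one_add, Homeomorph.mul_apply, ih, h1]
    push_cast
    ring_nf
  | pred i ih =>
    apply (ω.homeo (weight_invariant ω hω)).injective
    rw [← Homeomorph.mul_apply, ← zpow_one_add, add_sub_cancel, ih, h1]
    push_cast
    ring_nf

lemma circleItinerary_left (x : ℝ) (i : ℤ) :
    circleItinerary hU ω hω (ω.left x : S1) i = leftSymbol hU (x + i * ρ) := by
  rw [circleItinerary, homeo_zpow_left ω hω, circleSymbol_coe, coreSymbol_left]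

lemma circleItinerary_right (x : ℝ) (i : ℤ) :
    circleItinerary hU ω hω (ω.right x : S1) i = rightSymbol hU (x + i * ρ) := by
  rw [circleItinerary, homeo_zpow_right ω hω, circleSymbol_coe,
    coreSymbol_right hU ω (weight_frontier ω hω)]

lemma coe_add_zsmul (x ρ : ℝ) (i : ℤ) : (x : S1) + i • (ρ : S1) = ((x + i * ρ : ℝ) : S1) := by
  rw [AddCircle.coe_add, ← zsmul_eq_mul, AddCircle.coe_zsmul]

lemma mem_fib_circleItinerary {t : ℝ} (ht : t ∈ ω.core) :
    (ω.collapse t : S1) ∈ fib U (ρ : S1) (circleItinerary hU ω hω (t : S1)) := by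
  intro i
  rw [coe_add_zsmul]
  rcases ht with ht | ht
  · rw [ht, circleItinerary_left, Weight.collapse_left]
    exact mem_closure_leftSymbol hU _
  · rw [ht, circleItinerary_right, Weight.collapse_right]
    exact mem_closure_rightSymbol hU _

/-- A point just to the left, or right, of the collapsed point realizes any finite window of
one-sided symbols. -/
lemma circleItinerary_mem_LambdaSet {t : ℝ} (ht : t ∈ ω.core) :
    circleItinerary hU ω hω (t : S1) ∈ (LambdaSet U (ρ : S1) : Set Sigma2) := by
  rw [mem_LambdaSet_iff]
  intro N
  rcases ht with ht | ht
  · have : ∀ᶠ z : ℝ in 𝓝[<] (ω.collapse t), ∀ i ∈ Finset.Icc (-N : ℤ) N,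
        (z : S1) + i • (ρ : S1) ∈ U.side (circleItinerary hU ω hω (t : S1) i) := by
      rw [Filter.eventually_all_finset]
      intro i _
      rw [ht, circleItinerary_left, Weight.collapse_left]
      filter_upwards [(tendsto_add_nhdsLT (ω.collapse t) (i * ρ)).eventually
        (eventually_leftSymbol hU _)] with z hz
      rwa [coe_add_zsmul]
    obtain ⟨z, hz⟩ := this.exists
    exact ⟨z, fun i hi => hz i (by simpa [abs_le] using hi)⟩
  · have : ∀ᶠ z : ℝ in 𝓝[>] (ω.collapse t), ∀ i ∈ Finset.Icc (-N : ℤ) N,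
        (z : S1) + i • (ρ : S1) ∈ U.side (circleItinerary hU ω hω (t : S1) i) := by
      rw [Filter.eventually_all_finset]
      intro i _
      rw [ht, circleItinerary_right, Weight.collapse_right]
      filter_upwards [(tendsto_add_nhdsGT (ω.collapse t) (i * ρ)).eventually
        (eventually_rightSymbol hU _)] with z hz
      rwa [coe_add_zsmul]
    obtain ⟨z, hz⟩ := this.exists
    exact ⟨z, fun i hi => hz i (by simpa [abs_le] using hi)⟩

lemma image_circleItinerary :
    circleItinerary hU ω hω '' ω.circleCore = (LambdaSet U (ρ : S1) : Set Sigma2) := by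
  refine Subset.antisymm ?_ ?_
  · rintro _ ⟨_, ⟨t, ht, rfl⟩, rfl⟩
    exact circleItinerary_mem_LambdaSet hU ω hω ht
  · refine closure_minimal ?_ (ω.isClosed_circleCore.isCompact.image_of_continuousOn
      (continuousOn_circleItinerary hU ω hω)).isClosed
    rintro _ ⟨y, hy, rfl⟩
    obtain ⟨x, rfl⟩ := QuotientAddGroup.mk_surjective y
    refine ⟨(ω.left x : S1), ⟨ω.left x, by left; simp, rfl⟩, ?_⟩
    funext i
    rw [circleItinerary_left]
    refine leftSymbol_of_mem hU ?_
    rw [← coe_add_zsmul]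
    exact mem_side_itinerary hy i

lemma circleItinerary_left_ne_right {x : ℝ} (hx : ω.left x ≠ ω.right x) :
    circleItinerary hU ω hω (ω.left x : S1) ≠ circleItinerary hU ω hω (ω.right x : S1) := by
  have hw : ω.w (x : S1) ≠ 0 := fun h => hx (by rw [ω.right_eq, h, add_zero])
  rw [Ne, hω, mem_goodSet] at hw
  push Not at hw
  obtain ⟨i, hi⟩ := hw
  rw [coe_add_zsmul] at hi
  intro h
  have := congrFun h i
  rw [circleItinerary_left, circleItinerary_right] at this
  exact leftSymbol_ne_rightSymbol hU hi this

/-- By aperiodicity equal itineraries lie over the same circle point. After an integer shift both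
core points are ends of one interval, and opposite ends of a genuine interval have different
itineraries. -/
lemma injOn_circleItinerary (hA : U.Aperiodic) (hρ : DenseRange fun i : ℤ => i • (ρ : S1)) :
    InjOn (circleItinerary hU ω hω) ω.circleCore := by
  rintro _ ⟨t, ht, rfl⟩ _ ⟨t', ht', rfl⟩ heq
  have h1 := mem_fib_circleItinerary hU ω hω ht
  have h2 := mem_fib_circleItinerary hU ω hω ht'
  rw [← heq] at h2
  have h3 := hA.fib_subsingleton hρ _ h1 h2
  rw [← sub_eq_zero, ← AddCircle.coe_sub, AddCircle.coe_eq_zero_iff] at h3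
  obtain ⟨k, hk⟩ := h3
  have hcol : ω.collapse (t' + k) = ω.collapse t := by
    have : ∀ (k : ℤ) t, ω.collapse (t + k) = ω.collapse t + k := by
      intro k t
      have := ω.deg1Collapse.map_add_int t k
      exact this
    rw [this]
    simp only [zsmul_eq_mul, mul_one] at hk
    linarith
  have hcoe : ((t' + k : ℝ) : S1) = (t' : S1) := by
    rw [AddCircle.coe_add, add_eq_left, AddCircle.coe_eq_zero_iff]
    exact ⟨k, by simp⟩
  rw [← hcoe] at heq ⊢
  rw [← ω.core_add_intCast k] at ht'
  generalize t' + k = u at *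
  congr 1
  by_contra hne
  rcases ht with ht | ht <;> rcases ht' with ht' | ht' <;> rw [hcol] at ht'
  · exact hne (ht.trans ht'.symm)
  · rw [ht, ht'] at heq hne
    exact circleItinerary_left_ne_right hU ω hω hne heq
  · rw [ht, ht'] at heq hne
    exact circleItinerary_left_ne_right hU ω hω (Ne.symm hne) heq.symm
  · exact hne (ht.trans ht'.symm)

end Denjoy

theorem isDenjoyMinimalSet_of_aperiodic {U : RO} (hA : U.Aperiodic)
    (hU : (frontier U.carrier).Finite) {ρ : ℝ} (hρ : Irrational ρ) :
    IsDenjoyMinimalSet shift (LambdaSet U (ρ : S1) : Set Sigma2) (ρ : S1) := by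
  have hd : DenseRange fun i : ℤ => i • (ρ : S1) :=
    AddCircle.denseRange_zsmul_coe_iff.2 (by simpa using hρ)
  -- The points to be blown up are exactly those whose orbit meets the finite frontier.
  have hE : (goodSet U (ρ : S1))ᶜ.Countable := by
    rw [goodSet_eq, compl_iInter]
    refine countable_iUnion fun i => ?_
    rw [← preimage_compl, compl_compl]
    exact (hU.preimage (add_left_injective _).injOn).countable
  obtain ⟨ω, hω⟩ := exists_weight hE
  simp only [notMem_compl_iff] at hω
  have hgK := ω.image_homeo_circleCore (weight_invariant ω hω)
  have hK := ω.isClosed_circleCore.isCompact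
  have hc := continuousOn_circleItinerary hU ω hω
  have hi := injOn_circleItinerary hU ω hω hA hd
  have hY := image_circleItinerary hU ω hω
  have hmin : IsMinimalSet (ω.homeo (weight_invariant ω hω)) ω.circleCore :=
    IsMinimalSet.of_injOn hK hgK hc hi hY (fun x _ => circleItinerary_homeo hU ω hω x)
      (isMinimalSet_LambdaSet U hd)
  refine ⟨ω.homeo (weight_invariant ω hω), ω.circleCore, ⟨⟨ω.deg1Lift ρ,
    ω.continuous_lift (weight_invariant ω hω), fun _ => rfl, ?_, ?_⟩, fun huniv => ?_⟩, hmin,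
    AreConjugate.of_injOn hK hgK hc hi hY (fun x _ => circleItinerary_homeo hU ω hω x)
      (image_shift_LambdaSet U _)⟩
  · rwa [ω.translationNumber_deg1Lift]
  · rw [ω.translationNumber_deg1Lift]
  -- A frontier point is blown up, so the core is a proper closed invariant set and the
  -- homeomorphism is not minimal.
  · obtain ⟨e, he⟩ := U.frontier_nonempty
    refine ω.circleCore_ne_univ (weight_frontier ω hω e he) (eq_univ_of_univ_subset ?_)
    obtain ⟨x, hx⟩ := hmin.nonempty
    refine (huniv.dense_orbit x (mem_univ x)).trans
      (closure_minimal ?_ ω.isClosed_circleCore)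
    rintro _ ⟨i, rfl⟩
    exact zpow_mem_of_image_eq hgK i hx

/-! ### Periodic sequences -/

/-- The sequences with period `q`. -/
def perSeq (q : ℕ) : Set Sigma2 := {s | ∀ i : ℤ, s (i + q) = s i}

lemma shift_iterate_apply (s : Sigma2) (n : ℕ) (i : ℤ) : (shift^[n]) s i = s (i + n) := by
  induction n generalizing i with
  | zero => simp
  | succ n ih =>
    rw [Function.iterate_succ_apply']
    change (shift^[n]) s (i + 1) = _
    rw [ih]
    push_cast
    congr 1
    ring

lemma mem_perSeq_iff {q : ℕ} {s : Sigma2} : s ∈ perSeq q ↔ (shift^[q]) s = s := by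
  rw [funext_iff]
  simp only [shift_iterate_apply]
  rfl

lemma isPeriodicDividing_iff {q : ℕ} (hq : 0 < q) {s : Sigma2} :
    IsPeriodicDividing shift q s ↔ s ∈ perSeq q := by
  rw [mem_perSeq_iff, IsPeriodicDividing, ← Function.isPeriodicPt_iff_minimalPeriod_dvd]
  exact ⟨fun h => h.2, fun h => ⟨Function.mk_mem_periodicPts hq h, h⟩⟩

lemma perSeq_apply_of_dvd {q : ℕ} {s : Sigma2} (hs : s ∈ perSeq q) {i j : ℤ}
    (h : (q : ℤ) ∣ i - j) : s i = s j := by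
  obtain ⟨k, hk⟩ := h
  have key : ∀ k : ℤ, s (j + q * k) = s j := by
    intro k
    induction k with
    | zero => simp
    | succ k ih => rw [← ih, ← hs (j + q * k), mul_add, mul_one, add_assoc]
    | pred k ih => rw [← ih, ← hs, mul_sub, mul_one, add_assoc, sub_add_cancel]
  rw [← key k, ← hk, add_sub_cancel]

lemma shift_zpow_mem_perSeq {q : ℕ} {s : Sigma2} (hs : s ∈ perSeq q) (n : ℤ) :
    (shift ^ n) s ∈ perSeq q := by
  intro i
  rw [shift_zpow_apply, shift_zpow_apply, add_right_comm, hs]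

lemma finite_perSeq {q : ℕ} (hq : 0 < q) : (perSeq q).Finite := by
  refine Set.Finite.of_injOn (f := fun (s : Sigma2) (k : Fin q) => s k) (t := univ)
    (fun _ _ => mem_univ _) (fun s hs t ht h => ?_) finite_univ
  funext i
  have hq' : (0 : ℤ) < q := by exact_mod_cast hq
  have h1 : ∀ u ∈ perSeq q, u i = u (i % q) := fun u hu =>
    perSeq_apply_of_dvd hu ⟨i / q, by rw [eq_comm, Int.mul_ediv_self]; ⟩
  have h2 : (((i % q).toNat : ℕ) : ℤ) = i % q := Int.toNat_of_nonneg (Int.emod_nonneg _ hq'.ne')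
  have hlt : (i % q).toNat < q := by
    have := Int.emod_lt_of_pos i hq'
    omega
  rw [h1 s hs, h1 t ht, ← h2]
  exact congrFun h ⟨_, hlt⟩

lemma orbit_subset_perSeq {q : ℕ} {s : Sigma2} (hs : s ∈ perSeq q) : orbit shift s ⊆ perSeq q := by
  rintro _ ⟨n, rfl⟩
  exact shift_zpow_mem_perSeq hs n

section Rational

variable {r : S1} {q : ℕ} (hq : 0 < q) (hr : q • r = 0)
include hr

lemma itinerary_mem_perSeq (U : RO) (x : S1) : itinerary U r x ∈ perSeq q := by
  intro i
  rw [itinerary_apply, itinerary_apply, add_zsmul, natCast_zsmul, hr, add_zero]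

include hq

theorem exists_finset_LambdaSet (U : RO) :
    ∃ F : Finset Sigma2, F.Nonempty ∧ (∀ s ∈ F, IsPeriodicDividing shift q s) ∧
      (LambdaSet U r : Set Sigma2) = ⋃ s ∈ F, orbit shift s := by
  have hsub : itinerary U r '' goodSet U r ⊆ perSeq q := by
    rintro _ ⟨x, -, rfl⟩
    exact itinerary_mem_perSeq hr U x
  have hfin := (finite_perSeq hq).subset hsub
  -- There are finitely many `q`-periodic sequences, so taking the closure adds nothing.
  have hL : (LambdaSet U r : Set Sigma2) = itinerary U r '' goodSet U r :=
    hfin.isClosed.closure_eq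
  refine ⟨hfin.toFinset, ?_, fun s hs => ?_, ?_⟩
  · rw [Set.Finite.toFinset_nonempty]
    exact (dense_goodSet U r).nonempty.image _
  · exact (isPeriodicDividing_iff hq).2 (hsub (hfin.mem_toFinset.1 hs))
  · ext t
    simp only [Set.Finite.mem_toFinset, mem_iUnion]
    constructor
    · intro ht
      rw [hL] at ht
      exact ⟨t, ht, 0, by simp⟩
    · rintro ⟨s, hs, n, rfl⟩
      exact zpow_mem_of_image_eq (image_shift_LambdaSet U r) n (hL ▸ hs)

end Rational

/-! ### Measures carried by finitely many periodic orbits -/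

lemma le_of_forall_singleton_le {X : Type*} [MeasurableSpace X] [MeasurableSingletonClass X]
    {μ ν : Measure X} {P : Set X} (hP : P.Finite) (hμ : μ Pᶜ = 0)
    (h : ∀ t ∈ P, μ {t} ≤ ν {t}) : μ ≤ ν := by
  refine Measure.le_iff.2 fun A _ => ?_
  have hA : (A ∩ P).Finite := hP.subset inter_subset_right
  calc μ A = μ (A ∩ P) := (measure_inter_conull hμ).symm
    _ = ∑ t ∈ hA.toFinset, μ {t} := by rw [sum_measure_singleton, Set.Finite.coe_toFinset]
    _ ≤ ∑ t ∈ hA.toFinset, ν {t} :=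
      Finset.sum_le_sum fun t ht => h t (hA.mem_toFinset.1 ht).2
    _ = ν (A ∩ P) := by rw [sum_measure_singleton, Set.Finite.coe_toFinset]
    _ ≤ ν A := measure_mono inter_subset_left

/-- The invariant measure equidistributed on the orbit of a point of period `q`. -/
def orbitMeasure (q : ℕ) (s : Sigma2) : Measure Sigma2 :=
  (q : ENNReal)⁻¹ • ∑ k ∈ Finset.range q, Measure.dirac ((shift^[k]) s)

lemma orbitMeasure_apply (q : ℕ) (s : Sigma2) {A : Set Sigma2} (hA : MeasurableSet A) :
    orbitMeasure q s A =
      (q : ENNReal)⁻¹ * ∑ k ∈ Finset.range q, A.indicator 1 ((shift^[k]) s) := by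
  simp [orbitMeasure, Measure.dirac_apply' _ hA]

lemma isProbabilityMeasure_orbitMeasure {q : ℕ} (hq : 0 < q) (s : Sigma2) :
    IsProbabilityMeasure (orbitMeasure q s) := ⟨by
  rw [orbitMeasure_apply _ _ MeasurableSet.univ]
  simpa using ENNReal.inv_mul_cancel (by exact_mod_cast hq.ne') (ENNReal.natCast_ne_top q)⟩

lemma measurePreserving_orbitMeasure {q : ℕ} {s : Sigma2} (hs : s ∈ perSeq q) :
    MeasurePreserving shift (orbitMeasure q s) (orbitMeasure q s) := by
  refine ⟨shift.continuous.measurable, ?_⟩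
  ext A hA
  rw [Measure.map_apply shift.continuous.measurable hA, orbitMeasure_apply _ _ hA,
    orbitMeasure_apply _ _ (shift.continuous.measurable hA)]
  congr 1
  have h : ∀ k, (shift ⁻¹' A).indicator (1 : Sigma2 → ENNReal) ((shift^[k]) s) =
      A.indicator 1 ((shift^[k + 1]) s) := fun k => by
    rw [Function.iterate_succ_apply']
    rfl
  simp only [h]
  -- Cyclic reindexing: the terms at `0` and `q` agree by periodicity, and being finite they cancel.
  have h1 := Finset.sum_range_succ (fun k => A.indicator (1 : Sigma2 → ENNReal) ((shift^[k]) s)) q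
  rw [Finset.sum_range_succ', mem_perSeq_iff.1 hs, Function.iterate_zero_apply] at h1
  refine (ENNReal.add_left_inj ?_).1 h1
  by_cases h : s ∈ A <;> simp [h]

/-- `orbitMeasure` as an invariant probability measure. -/
def orbitInvMeasure {q : ℕ} (hq : 0 < q) {s : Sigma2} (hs : s ∈ perSeq q) : InvMeasure shift :=
  ⟨⟨orbitMeasure q s, isProbabilityMeasure_orbitMeasure hq s⟩, measurePreserving_orbitMeasure hs⟩

lemma orbitInvMeasure_mem {q : ℕ} (hq : 0 < q) {s : Sigma2} (hs : s ∈ perSeq q) :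
    orbitInvMeasure hq hs ∈ periodicOrbitMeasures shift q := by
  refine ⟨s, (isPeriodicDividing_iff hq).2 hs, ?_⟩
  change orbitMeasure q s _ = 0
  have hm : MeasurableSet (orbit shift s) :=
    ((finite_perSeq hq).subset (orbit_subset_perSeq hs)).measurableSet
  rw [orbitMeasure_apply _ _ hm.compl]
  have : ∀ k, (shift^[k]) s ∈ orbit shift s := fun k => ⟨k, by
    funext i
    exact (shift_zpow_apply s k i).trans (shift_iterate_apply s k i).symm⟩
  simp [this]

/-- Write `μ` as a sum of weighted point masses and average over `q` iterates of the shift: `μ` is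
unchanged, and each point mass becomes an orbit measure. -/
lemma toSignedMeasure_eq_sum {q : ℕ} (hq : 0 < q) {μ : Measure Sigma2} [IsProbabilityMeasure μ]
    (hμ : MeasurePreserving shift μ μ) (h : μ (perSeq q)ᶜ = 0) :
    μ.toSignedMeasure = ∑ s ∈ (finite_perSeq hq).toFinset.attach, μ.real {s.1} •
      ((orbitInvMeasure hq ((finite_perSeq hq).mem_toFinset.1 s.2)).1 :
        Measure Sigma2).toSignedMeasure := by
  have hB : ∀ B : Set Sigma2, μ.real B =
      ∑ s ∈ (finite_perSeq hq).toFinset, μ.real {s} * B.indicator 1 s := by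
    classical
    intro B
    simp only [indicator_apply, mul_ite, Pi.one_apply, mul_one, mul_zero]
    rw [← Finset.sum_filter, sum_measureReal_singleton, measureReal_def, measureReal_def,
      ← measure_inter_conull h]
    congr 2
    ext s
    simp [and_comm]
  have hit : ∀ k A, MeasurableSet A → μ.real A =
      ∑ s ∈ (finite_perSeq hq).toFinset, μ.real {s} * A.indicator 1 ((shift^[k]) s) := by
    intro k A hA
    rw [measureReal_def, ← (hμ.iterate k).measure_preimage hA.nullMeasurableSet,
      ← measureReal_def, hB]
    rfl
  have hreal : ∀ s {A : Set Sigma2}, MeasurableSet A → (orbitMeasure q s).real A =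
      (q : ℝ)⁻¹ * ∑ k ∈ Finset.range q, A.indicator 1 ((shift^[k]) s) := by
    intro s A hA
    rw [measureReal_def, orbitMeasure_apply _ _ hA, ENNReal.toReal_mul, ENNReal.toReal_inv,
      ENNReal.toReal_natCast, ENNReal.toReal_sum]
    · congr 1
      refine Finset.sum_congr rfl fun k _ => ?_
      by_cases h : (shift^[k]) s ∈ A <;> simp [h]
    · intro k _
      by_cases h : (shift^[k]) s ∈ A <;> simp [h]
  refine VectorMeasure.ext fun A hA => ?_
  rw [Measure.toSignedMeasure_apply_measurable hA]
  have hsum : ∀ (F : Finset (finite_perSeq hq).toFinset)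
      (v : (finite_perSeq hq).toFinset → SignedMeasure Sigma2),
      (∑ s ∈ F, v s) A = ∑ s ∈ F, v s A := fun F v =>
    map_sum (AddMonoidHom.mk' (fun w : SignedMeasure Sigma2 => w A) fun _ _ => rfl) v F
  rw [hsum]
  have hterm : ∀ s : (finite_perSeq hq).toFinset, (μ.real {s.1} •
      ((orbitInvMeasure hq ((finite_perSeq hq).mem_toFinset.1 s.2)).1 :
        Measure Sigma2).toSignedMeasure) A =
      μ.real {s.1} * ((q : ℝ)⁻¹ * ∑ k ∈ Finset.range q, A.indicator 1 ((shift^[k]) s.1)) := by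
    intro s
    rw [← hreal s.1 hA, smul_apply, Measure.toSignedMeasure_apply_measurable hA]
    rfl
  simp only [hterm]
  rw [Finset.sum_attach _ fun s : Sigma2 => μ.real {s} *
    ((q : ℝ)⁻¹ * ∑ k ∈ Finset.range q, A.indicator 1 ((shift^[k]) s))]
  simp only [mul_left_comm _ (q : ℝ)⁻¹, Finset.mul_sum _ _ (μ.real _)]
  rw [← Finset.mul_sum, Finset.sum_comm]
  simp only [← hit _ A hA, Finset.sum_const, Finset.card_range, nsmul_eq_mul]
  rw [inv_mul_cancel_left₀ (by exact_mod_cast hq.ne')]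

theorem mem_measureHull_iff {q : ℕ} (hq : 0 < q) (μ : InvMeasure shift) :
    μ ∈ measureHull (periodicOrbitMeasures shift q) ↔ (μ.1 : Measure Sigma2) (perSeq q)ᶜ = 0 := by
  have hm : MeasurableSet (perSeq q)ᶜ := (finite_perSeq hq).measurableSet.compl
  constructor
  · intro h
    -- Vanishing on a fixed set is a linear condition, so it passes to the convex hull.
    let C : Set (SignedMeasure Sigma2) := {v | v (perSeq q)ᶜ = 0}
    have hC : Convex ℝ C := by
      intro v hv w hw a b _ _ _
      change (a • v + b • w) _ = 0
      simp only [C, mem_ofPred_eq] at hv hw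
      simp [hv, hw]
    have hsub : (fun ν : InvMeasure shift => (ν.1 : Measure Sigma2).toSignedMeasure) ''
        periodicOrbitMeasures shift q ⊆ C := by
      rintro _ ⟨ν, ⟨s, hs, hν⟩, rfl⟩
      change (ν.1 : Measure Sigma2).toSignedMeasure _ = 0
      rw [Measure.toSignedMeasure_apply_measurable hm, measureReal_eq_zero_iff]
      exact measure_mono_null (compl_subset_compl.2
        (orbit_subset_perSeq ((isPeriodicDividing_iff hq).1 hs))) hν
    have := convexHull_min hsub hC h
    change (μ.1 : Measure Sigma2).toSignedMeasure _ = 0 at this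
    rwa [Measure.toSignedMeasure_apply_measurable hm, measureReal_eq_zero_iff] at this
  · intro h
    change (μ.1 : Measure Sigma2).toSignedMeasure ∈ convexHull ℝ _
    rw [toSignedMeasure_eq_sum hq μ.2 h]
    refine (convex_convexHull ℝ _).sum_mem (fun _ _ => measureReal_nonneg) ?_
      fun s hs => subset_convexHull ℝ _ ⟨_, orbitInvMeasure_mem hq _, rfl⟩
    rw [Finset.sum_attach _ fun s => (μ.1 : Measure Sigma2).real {s}, sum_measureReal_singleton,
      Set.Finite.coe_toFinset, measureReal_def, (prob_compl_eq_zero_iff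
      (finite_perSeq hq).measurableSet).1 h, ENNReal.toReal_one]

/-! ### Realizing measures on periodic sequences -/

lemma exists_disjoint_intervals {ι : Type*} (F : Finset ι) {b : ι → ℝ} (hb : ∀ i, 0 ≤ b i) :
    ∃ l : ι → ℝ, (∀ i ∈ F, 0 ≤ l i ∧ l i + b i ≤ ∑ j ∈ F, b j) ∧
      ∀ i ∈ F, ∀ j ∈ F, ∀ y, y ∈ Ioo (l i) (l i + b i) → y ∈ Ioo (l j) (l j + b j) → i = j := by
  classical
  induction F using Finset.induction_on with
  | empty => exact ⟨0, by simp, by simp⟩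
  | insert a F ha ih =>
    obtain ⟨l, hl, hd⟩ := ih
    have hne : ∀ i ∈ F, i ≠ a := fun i hi h => ha (h ▸ hi)
    have hS : 0 ≤ ∑ j ∈ F, b j := Finset.sum_nonneg fun j _ => hb j
    refine ⟨Function.update l a (∑ j ∈ F, b j), fun i hi => ?_, fun i hi j hj y hyi hyj => ?_⟩
    · rw [Finset.sum_insert ha]
      rcases Finset.mem_insert.1 hi with rfl | hi
      · rw [Function.update_self]
        exact ⟨hS, by linarith⟩
      · rw [Function.update_of_ne (hne i hi)]
        exact ⟨(hl i hi).1, by linarith [(hl i hi).2, hb a]⟩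
    · rcases Finset.mem_insert.1 hi with hia | hi <;> rcases Finset.mem_insert.1 hj with hja | hj
      · exact hia.trans hja.symm
      · rw [hia, Function.update_self] at hyi
        rw [Function.update_of_ne (hne j hj)] at hyj
        linarith [hyi.1, hyj.2, (hl j hj).2]
      · rw [hja, Function.update_self] at hyj
        rw [Function.update_of_ne (hne i hi)] at hyi
        linarith [hyj.1, hyi.2, (hl i hi).2]
      · rw [Function.update_of_ne (hne i hi)] at hyi
        rw [Function.update_of_ne (hne j hj)] at hyj
        exact hd i hi j hj y hyi hyj

/-- The arc over `(c, d) / q`, rotated by `k • r`. -/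
def tile (r : S1) (q : ℕ) (c d : ℝ) (k : ℤ) : Set S1 :=
  (fun x => x + k • r) '' ((fun y : ℝ => ((y / q : ℝ) : S1)) '' Ioo c d)

lemma isOpen_tile {q : ℕ} (hq : 0 < q) (r : S1) (c d : ℝ) (k : ℤ) : IsOpen (tile r q c d k) := by
  refine (Homeomorph.addRight (k • r)).isOpenMap _ ?_
  have h : IsOpenMap fun y : ℝ => y / (q : ℝ) := by
    simp only [div_eq_mul_inv]
    exact (Homeomorph.mulRight₀ (q : ℝ)⁻¹ (inv_ne_zero (by exact_mod_cast hq.ne'))).isOpenMap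
  exact (QuotientAddGroup.isOpenMap_coe.comp h) _ isOpen_Ioo

lemma add_mem_tile {r x : S1} {q : ℕ} {c d : ℝ} {k : ℤ} (hx : x ∈ tile r q c d k) (i : ℤ) :
    x + i • r ∈ tile r q c d (k + i) := by
  obtain ⟨y, hy, rfl⟩ := hx
  refine ⟨y, hy, ?_⟩
  simp only [add_zsmul, add_assoc]

/-- A lower bound suffices, since comparing total masses later forces equality. -/
lemma le_measure_tile {q : ℕ} (hq : 0 < q) (r : S1) {c d : ℝ} (hc : 0 ≤ c) (hd : d ≤ 1) (k : ℤ) :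
    ENNReal.ofReal ((d - c) / q) ≤ m (tile r q c d k) := by
  have hq' : (0 : ℝ) < q := by exact_mod_cast hq
  have hq1 : (1 : ℝ) ≤ q := by exact_mod_cast hq
  have hv : (volume : Measure S1) = m := by
    rw [AddCircle.volume_eq_smul_haarAddCircle]
    simp
  have ho : IsOpen ((fun y : ℝ => ((y / q : ℝ) : S1)) '' Ioo c d) := by
    simpa [tile] using isOpen_tile hq 0 c d 0
  rw [tile, image_add_right, measure_preimage_add_right, ← hv,
    ← (AddCircle.measurePreserving_mk 1 0).measure_preimage ho.measurableSet.nullMeasurableSet,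
    Measure.restrict_apply (ho.measurableSet.preimage AddCircle.measurable_mk')]
  have : Ioo (c / q) (d / q) ⊆ (fun x : ℝ => (x : S1)) ⁻¹'
      ((fun y : ℝ => ((y / q : ℝ) : S1)) '' Ioo c d) ∩ Ioc 0 (0 + 1) := by
    intro z hz
    have h1 : c < z * q := (div_lt_iff₀ hq').1 hz.1
    have h2 : z * q < d := (lt_div_iff₀ hq').1 hz.2
    refine ⟨⟨z * q, ⟨h1, h2⟩, ?_⟩, ?_, ?_⟩
    · simp only [mul_div_cancel_right₀ z hq'.ne']
    · exact (div_nonneg hc hq'.le).trans_lt hz.1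
    · have : d / q ≤ 1 := (div_le_one hq').2 (hd.trans hq1)
      linarith [hz.2]
  refine le_trans ?_ (measure_mono this)
  rw [Real.volume_Ioo, sub_div]

section

variable {p : ℤ} {q : ℕ} (hq : 0 < q)
include hq

lemma nsmul_rat_eq_zero : q • (((p : ℝ) / (q : ℝ) : ℝ) : S1) = 0 := by
  have hq' : (q : ℝ) ≠ 0 := by exact_mod_cast hq.ne'
  rw [← AddCircle.coe_nsmul, nsmul_eq_mul, mul_div_cancel₀ _ hq', AddCircle.coe_eq_zero_iff]
  exact ⟨p, by simp⟩

/-- After multiplication by `q`, the base coordinates differ by an integer of absolute value below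
one, hence agree. Then `q` divides `(k - k') * p`, and coprimality applies. -/
lemma tile_unique (hpq : IsCoprime p (q : ℤ)) {x : S1} {c d c' d' : ℝ} {k k' : ℤ}
    (hc : 0 ≤ c) (hd : d ≤ 1) (hc' : 0 ≤ c') (hd' : d' ≤ 1)
    (hx : x ∈ tile (((p : ℝ) / (q : ℝ) : ℝ) : S1) q c d k)
    (hx' : x ∈ tile (((p : ℝ) / (q : ℝ) : ℝ) : S1) q c' d' k') :
    (q : ℤ) ∣ k - k' ∧ ∃ y, y ∈ Ioo c d ∧ y ∈ Ioo c' d' := by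
  have hq' : (q : ℝ) ≠ 0 := by exact_mod_cast hq.ne'
  obtain ⟨_, ⟨y, hy, rfl⟩, rfl⟩ := hx
  obtain ⟨_, ⟨y', hy', rfl⟩, h⟩ := hx'
  simp only [coe_add_zsmul] at h
  rw [eq_comm, ← sub_eq_zero, ← AddCircle.coe_sub, AddCircle.coe_eq_zero_iff] at h
  obtain ⟨j, hj⟩ := h
  simp only [zsmul_eq_mul, mul_one] at hj
  have h1 : y - y' = ((j * q - (k - k') * p : ℤ) : ℝ) := by
    push_cast
    field_simp at hj
    linarith
  have h2 : j * q - (k - k') * p = 0 := by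
    have h3 : ((j * q - (k - k') * p : ℤ) : ℝ) < 1 := by linarith [hy.2, hy'.1]
    have h4 : (-1 : ℝ) < ((j * q - (k - k') * p : ℤ) : ℝ) := by linarith [hy.1, hy'.2]
    have h3' : j * q - (k - k') * p < 1 := by exact_mod_cast h3
    have h4' : -1 < j * q - (k - k') * p := by exact_mod_cast h4
    omega
  refine ⟨hpq.symm.dvd_of_dvd_mul_right ⟨j, by linarith⟩, y, hy, ?_⟩
  rw [h2, Int.cast_zero, sub_eq_zero] at h1
  rwa [h1]

/-- The tiles with symbol `0` and those with symbol `1` form disjoint open sets, so regularizing the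
latter keeps it off the former. The hypothesis `hne` makes the result nonempty and proper. -/
lemma exists_RO_of_tiles (hpq : IsCoprime p (q : ℤ)) {F : Finset Sigma2}
    (hF : ∀ s ∈ F, s ∈ perSeq q) {b l : Sigma2 → ℝ}
    (hl : ∀ s ∈ F, 0 ≤ l s ∧ l s + b s ≤ 1)
    (hd : ∀ s ∈ F, ∀ t ∈ F, ∀ y, y ∈ Ioo (l s) (l s + b s) → y ∈ Ioo (l t) (l t + b t) → s = t)
    (hne : ∀ e : Fin 2, ∃ s ∈ F, 0 < b s ∧ ∃ k : ℤ, s k = e) :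
    ∃ U : RO, ∀ s ∈ F, ∀ k : ℤ,
      tile (((p : ℝ) / (q : ℝ) : ℝ) : S1) q (l s) (l s + b s) k ⊆ U.side (s k) := by
  set r : S1 := (((p : ℝ) / (q : ℝ) : ℝ) : S1) with hr
  let A : Fin 2 → Set S1 := fun e =>
    ⋃ s ∈ F, ⋃ (k : ℤ) (_ : s k = e), tile r q (l s) (l s + b s) k
  have hmem : ∀ e x, x ∈ A e ↔ ∃ s ∈ F, ∃ k : ℤ, s k = e ∧
      x ∈ tile r q (l s) (l s + b s) k := fun e x => by
    simp only [A, mem_iUnion, exists_prop]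
  have ho : ∀ e, IsOpen (A e) := fun e =>
    isOpen_biUnion fun s _ => isOpen_iUnion fun k => isOpen_iUnion fun _ =>
      isOpen_tile hq r _ _ _
  have hdis : Disjoint (A 0) (A 1) := by
    rw [disjoint_left]
    intro x h0 h1
    obtain ⟨s, hs, k, hsk, hx⟩ := (hmem _ _).1 h0
    obtain ⟨t, ht, k', htk, hx'⟩ := (hmem _ _).1 h1
    obtain ⟨hkk, y, hy, hy'⟩ := tile_unique hq hpq (hl s hs).1 (hl s hs).2 (hl t ht).1
      (hl t ht).2 hx hx'
    obtain rfl := hd s hs t ht y hy hy'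
    have := perSeq_apply_of_dvd (hF s hs) hkk
    rw [hsk, htk] at this
    exact absurd this (by decide)
  have hAne : ∀ e, (A e).Nonempty := by
    intro e
    obtain ⟨s, hs, hbs, k, hk⟩ := hne e
    have : (tile r q (l s) (l s + b s) k).Nonempty :=
      ((nonempty_Ioo.2 (by linarith)).image _).image _
    obtain ⟨x, hx⟩ := this
    exact ⟨x, (hmem _ _).2 ⟨s, hs, k, hk, hx⟩⟩
  have h1 : A 1 ⊆ interior (closure (A 1)) := (ho 1).subset_interior_closure
  have h0 : Disjoint (A 0) (closure (A 1)) := hdis.closure_right (ho 0)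
  let U : RO := ⟨interior (closure (A 1)), (hAne 1).mono h1, fun hu => by
      obtain ⟨x, hx⟩ := hAne 0
      exact disjoint_left.1 h0 hx (interior_subset (hu ▸ mem_univ x)), interior_closure_idem⟩
  have hside : ∀ e, A e ⊆ U.side e := by
    intro e
    fin_cases e
    · refine (subset_interior_iff_isOpen.2 (ho 0)).trans ?_
      rw [Fin.zero_eta, RO.side_zero, dual]
      exact interior_mono fun x hx hU => disjoint_left.1 h0 hx (interior_subset hU)
    · simpa [U] using h1
  exact ⟨U, fun s hs k x hx => hside _ ((hmem _ _).2 ⟨s, hs, k, rfl, hx⟩)⟩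

lemma exists_RO0_pushMeasure_eq (hpq : IsCoprime p (q : ℤ)) (μ : InvMeasure shift)
    (hμ : (μ.1 : Measure Sigma2) (perSeq q)ᶜ = 0)
    (hne : ∀ e : Fin 2, (μ.1 : Measure Sigma2) ≠ Measure.dirac fun _ => e) :
    ∃ U : RO0, lambdaMeasure U (((p : ℝ) / (q : ℝ) : ℝ) : S1) = μ := by
  set r : S1 := (((p : ℝ) / (q : ℝ) : ℝ) : S1) with hr
  have hq' : (0 : ℝ) < q := by exact_mod_cast hq
  have hfin := finite_perSeq hq
  set ν : Measure Sigma2 := (μ.1 : Measure Sigma2) with hν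
  have hprob : IsProbabilityMeasure ν := μ.1.2
  have hsum : ∑ s ∈ hfin.toFinset, ν.real {s} = 1 := by
    rw [sum_measureReal_singleton, hfin.coe_toFinset, measureReal_def,
      (prob_compl_eq_zero_iff hfin.measurableSet).1 hμ, ENNReal.toReal_one]
  obtain ⟨l, hl, hd⟩ := exists_disjoint_intervals hfin.toFinset
    (b := fun s => ν.real {s}) fun _ => measureReal_nonneg
  rw [hsum] at hl
  -- If a symbol occurred in no atom, every atom would be the other constant sequence and `ν` a
  -- point mass.
  have hne' : ∀ e : Fin 2, ∃ s ∈ hfin.toFinset, 0 < ν.real {s} ∧ ∃ k : ℤ, s k = e := by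
    intro e
    by_contra! hcon
    have hflip : ∀ e : Fin 2, ∃ e' : Fin 2, ∀ a : Fin 2, a ≠ e → a = e' := by decide
    obtain ⟨e', he'⟩ := hflip e
    refine hne e' (Measure.eq_of_le_of_isProbabilityMeasure
      (le_of_forall_singleton_le hfin hμ fun t ht => ?_))
    by_cases h0 : ν.real {t} = 0
    · rw [(measureReal_eq_zero_iff).1 h0]
      exact zero_le
    · have htc : t = fun _ => e' := funext fun k => he' _
        (hcon t (hfin.mem_toFinset.2 ht) (lt_of_le_of_ne measureReal_nonneg (Ne.symm h0)) k)
      rw [htc, Measure.dirac_apply_of_mem (mem_singleton _)]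
      exact prob_le_one
  obtain ⟨U, hU⟩ := exists_RO_of_tiles hq hpq (fun s hs => hfin.mem_toFinset.1 hs) hl hd hne'
  have hinv : ∀ (t : Sigma2) (k : ℕ), ν {(shift ^ (-(k : ℤ))) t} = ν {t} := by
    intro t k
    rw [← (μ.2.iterate k).measure_preimage (measurableSet_singleton t).nullMeasurableSet]
    congr 1
    ext s
    simp only [mem_singleton_iff, mem_preimage]
    have hk : (shift^[k]) s = (shift ^ (k : ℤ)) s := funext fun i =>
      (shift_iterate_apply s k i).trans (shift_zpow_apply s k i).symm
    rw [hk]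
    constructor
    · rintro rfl
      rw [← Homeomorph.mul_apply, ← zpow_add, add_neg_cancel, zpow_zero, Homeomorph.one_apply]
    · rintro rfl
      rw [← Homeomorph.mul_apply, ← zpow_add, neg_add_cancel, zpow_zero, Homeomorph.one_apply]
  have hle : ∀ t ∈ perSeq q, ν {t} ≤ pushMeasure U r {t} := by
    intro t ht
    rw [pushMeasure_apply _ _ (measurableSet_singleton t)]
    -- A point of the tile at level `k` built on `s` has itinerary `s` shifted by `k`; taking `s` to
    -- be `t` shifted back gives itinerary `t`. These `q` disjoint tiles have equal base lengths by
    -- invariance of `ν`.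
    let T : ℕ → Set S1 := fun k => tile r q (l ((shift ^ (-(k : ℤ))) t))
      (l ((shift ^ (-(k : ℤ))) t) + ν.real {(shift ^ (-(k : ℤ))) t}) k
    have hs : ∀ k : ℕ, (shift ^ (-(k : ℤ))) t ∈ hfin.toFinset := fun k =>
      hfin.mem_toFinset.2 (shift_zpow_mem_perSeq ht _)
    have hsub : (⋃ k ∈ Finset.range q, T k) ⊆ {x ∈ goodSet U r | itinerary U r x ∈ ({t} : Set _)} := by
      intro x hx
      simp only [mem_iUnion] at hx
      obtain ⟨k, -, hx⟩ := hx
      have hside : ∀ i : ℤ, x + i • r ∈ U.side (t i) := by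
        intro i
        have := hU _ (hs k) (k + i) (add_mem_tile hx i)
        rwa [shift_zpow_apply, add_comm (k : ℤ), add_neg_cancel_right] at this
      exact ⟨mem_goodSet_of_mem_side hside, funext fun i => itinerary_eq_of_mem_side (hside i)⟩
    have hdisj : (Finset.range q : Set ℕ).PairwiseDisjoint T := by
      intro k hk k' hk' hkk
      refine disjoint_left.2 fun x hx hx' => hkk ?_
      obtain ⟨j, hj⟩ := (tile_unique hq hpq (hl _ (hs k)).1 (hl _ (hs k)).2 (hl _ (hs k')).1
        (hl _ (hs k')).2 hx hx').1
      have h1 := Finset.mem_range.1 hk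
      have h2 := Finset.mem_range.1 hk'
      have hj0 : j = 0 := by
        have hq1 : (0 : ℤ) < q := by exact_mod_cast hq
        have h3 : (q : ℤ) * j < q * 1 := by omega
        have h4 : (q : ℤ) * (-1) < q * j := by omega
        have := lt_of_mul_lt_mul_left h3 hq1.le
        have := lt_of_mul_lt_mul_left h4 hq1.le
        omega
      rw [hj0, mul_zero] at hj
      omega
    calc ν {t} = ∑ k ∈ Finset.range q, ENNReal.ofReal (ν.real {t} / q) := by
          rw [Finset.sum_const, Finset.card_range, nsmul_eq_mul,
            ENNReal.ofReal_div_of_pos hq', ENNReal.ofReal_natCast, ofReal_measureReal,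
            ENNReal.mul_div_cancel (by exact_mod_cast hq.ne') (ENNReal.natCast_ne_top q)]
      _ ≤ ∑ k ∈ Finset.range q, m (T k) := by
          refine Finset.sum_le_sum fun k _ => ?_
          refine le_trans (le_of_eq ?_) (le_measure_tile hq r (hl _ (hs k)).1 (hl _ (hs k)).2 k)
          rw [add_sub_cancel_left, measureReal_def, measureReal_def, hinv]
      _ = m (⋃ k ∈ Finset.range q, T k) :=
          (measure_biUnion_finset hdisj fun k _ => (isOpen_tile hq r _ _ _).measurableSet).symm
      _ ≤ _ := measure_mono hsub
  have hle' := le_of_forall_singleton_le hfin hμ hle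
  -- Domination of a probability measure forces the good set to have full measure, and the frontier
  -- misses it.
  have hfr : m (frontier U.carrier) = 0 := by
    have h1 : 1 ≤ m (goodSet U r) := by
      have := hle' univ
      rw [measure_univ, pushMeasure_apply _ _ MeasurableSet.univ] at this
      simpa using this
    have h2 : m (goodSet U r)ᶜ = 0 :=
      (prob_compl_eq_zero_iff (measurableSet_goodSet U r)).2 (le_antisymm prob_le_one h1)
    have h3 : frontier U.carrier ⊆ (goodSet U r)ᶜ := fun x hx hg =>
      mem_goodSet.1 hg 0 (by simpa using hx)
    exact measure_mono_null h3 h2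
  have := isProbabilityMeasure_pushMeasure ⟨U, hfr⟩ r
  exact ⟨⟨U, hfr⟩, Subtype.ext (Subtype.ext (Measure.eq_of_le_of_isProbabilityMeasure hle').symm)⟩

theorem range_lambdaMap_rational (hpq : IsCoprime p (q : ℤ)) :
    (range fun u : RO0' => lambdaMap (u, (((p : ℝ) / (q : ℝ) : ℝ) : S1))) =
      measureHull (periodicOrbitMeasures shift q) \
        {μ | (μ.1 : Measure Sigma2) = Measure.dirac (fun _ => 0) ∨
          (μ.1 : Measure Sigma2) = Measure.dirac (fun _ => 1)} := by
  ext μ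
  constructor
  · rintro ⟨u, rfl⟩
    induction u using Quotient.inductionOn with
    | h U =>
      set r : S1 := (((p : ℝ) / (q : ℝ) : ℝ) : S1)
      -- The opposite side of `U` is open and nonempty, so the other symbol occurs at time `0` with
      -- positive probability.
      have hne : ∀ e e' : Fin 2, e ≠ e' → pushMeasure U.1 r ≠ Measure.dirac fun _ => e := by
        intro e e' hee h
        have hpos : 0 < pushMeasure U.1 r (cyl (fun _ => e') 0) := by
          rw [pushMeasure_cyl]
          refine (isOpen_box _ _ _ _).measure_pos m ?_
          obtain ⟨x, hx⟩ := U.1.side_nonempty e'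
          refine ⟨x, fun i hi => ?_⟩
          have : i = 0 := by simpa using hi
          simpa [this] using hx
        rw [h, Measure.dirac_apply' _ (isOpen_cyl _ _).measurableSet, indicator_of_notMem] at hpos
        · exact lt_irrefl _ hpos
        · exact fun hc => hee (hc 0 (by simp))
      refine ⟨(mem_measureHull_iff hq _).2 ?_, ?_⟩
      · change pushMeasure U.1 r _ = 0
        rw [pushMeasure_apply _ _ (finite_perSeq hq).measurableSet.compl]
        convert measure_empty (μ := m)
        ext x
        simpa using fun _ => itinerary_mem_perSeq (nsmul_rat_eq_zero hq) U.1 x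
      · rintro (h | h)
        · exact hne 0 1 (by decide) h
        · exact hne 1 0 (by decide) h
  · rintro ⟨h1, h2⟩
    rw [mem_measureHull_iff hq] at h1
    obtain ⟨U, hU⟩ := exists_RO0_pushMeasure_eq hq hpq μ h1 fun e he => h2 (by
      fin_cases e
      exacts [Or.inl he, Or.inr he])
    exact ⟨Quotient.mk _ U, hU⟩

end

end DenjoyDisks
end

/-! ### Assembly, with reduction to sets without symmetry. -/

open DenjoyDisks in
theorem theorem2 :
    -- (1) continuity of `λ` and lower semicontinuity of `Λ`
    (Continuous lambdaMap ∧ IsLowerSemicontinuous LambdaMap) ∧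
    -- (2) irrational `α`
    (∀ α : ℝ, Irrational α →
      -- (a)
      (∀ U : RO, IsMinimalSet shift (LambdaMap (⟦U⟧, (α : S1)) : Set Sigma2) ∧
        ∃ n : ℕ, 1 ≤ n ∧ IsAlmostOneToOneExtension shift
          (LambdaMap (⟦U⟧, (α : S1)) : Set Sigma2) (rot (n • (α : S1)))) ∧
      -- (b)
      (∀ U : RO, m (frontier U.carrier) = 0 →
        IsUniquelyErgodic shift (LambdaMap (⟦U⟧, (α : S1)) : Set Sigma2)) ∧
      -- (c)
      (∀ U : RO, (frontier U.carrier).Finite →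
        ∃ n : ℕ, 1 ≤ n ∧ IsDenjoyMinimalSet shift
          (LambdaMap (⟦U⟧, (α : S1)) : Set Sigma2) (n • (α : S1))) ∧
      -- (d)
      (Function.Injective fun u : RO' => LambdaMap (u, (α : S1))) ∧
      (Function.Injective fun u : RO0' => lambdaMap (u, (α : S1)))) ∧
    -- (3) rational `p / q` in lowest terms
    (∀ (p : ℤ) (q : ℕ), 0 < q → IsCoprime p (q : ℤ) →
      -- (a)
      (∀ U : RO, ∃ F : Finset Sigma2, F.Nonempty ∧ (∀ s ∈ F, IsPeriodicDividing shift q s) ∧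
        (LambdaMap (⟦U⟧, (((p : ℝ) / (q : ℝ) : ℝ) : S1)) : Set Sigma2) =
          ⋃ s ∈ F, orbit shift s) ∧
      -- (b)
      (Set.range fun u : RO0' => lambdaMap (u, (((p : ℝ) / (q : ℝ) : ℝ) : S1))) =
        measureHull (periodicOrbitMeasures shift q) \
          {μ | (μ.1 : MeasureTheory.Measure Sigma2) = MeasureTheory.Measure.dirac (fun _ => 0) ∨
            (μ.1 : MeasureTheory.Measure Sigma2) = MeasureTheory.Measure.dirac (fun _ => 1)}) := by
  refine ⟨⟨continuous_lambdaMap, isLowerSemicontinuous_LambdaMap⟩, fun α hα => ?_,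
    fun p q hq hpq => ⟨fun U => exists_finset_LambdaSet hq (nsmul_rat_eq_zero hq) U,
      range_lambdaMap_rational hq hpq⟩⟩
  have hd : ∀ {β : ℝ}, Irrational β → DenseRange fun i : ℤ => i • (β : S1) := fun hβ =>
    AddCircle.denseRange_zsmul_coe_iff.2 (by simpa using hβ)
  have hnα : ∀ n : ℕ, n • (α : S1) = ((n * α : ℝ) : S1) := fun n => by
    rw [← AddCircle.coe_nsmul, nsmul_eq_mul]
  have hirr : ∀ n : ℕ, 1 ≤ n → Irrational (n * α) := fun n hn => hα.natCast_mul (by omega)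
  have hL : ∀ {U V : RO} {n : ℕ}, 1 ≤ n → U.carrier = (fun x => n • x) ⁻¹' V.carrier →
      LambdaMap (⟦U⟧, (α : S1)) = LambdaSet V ((n * α : ℝ) : S1) := fun hn h => by
    rw [← hnα]
    exact LambdaSet_eq_of_preimage hn h _
  refine ⟨fun U => ⟨isMinimalSet_LambdaSet U (hd hα), ?_⟩, fun U hU => ?_, fun U hU => ?_,
    injective_LambdaMap (hd hα), injective_lambdaMap (hd hα)⟩
  · obtain ⟨n, hn, V, hV, h⟩ := U.exists_aperiodic
    refine ⟨n, hn, ?_⟩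
    rw [hL hn h, hnα]
    exact isAlmostOneToOneExtension_of_aperiodic hV (hd (hirr n hn))
  · obtain ⟨n, hn, V, hV, h⟩ := U.exists_aperiodic
    rw [hL hn h]
    refine isUniquelyErgodic_of_aperiodic hV (hd (hirr n hn)) ?_
    -- Multiplication by `n` preserves Haar measure, so the frontier of `V` is null along with its
    -- preimage.
    rwa [← (measurePreserving_nsmul hn).measure_preimage
      isClosed_frontier.measurableSet.nullMeasurableSet, ← RO.frontier_eq_preimage hn h]
  · obtain ⟨n, hn, V, hV, h⟩ := U.exists_aperiodic
    refine ⟨n, hn, ?_⟩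
    rw [hL hn h, hnα]
    refine isDenjoyMinimalSet_of_aperiodic hV ?_ (hirr n hn)
    rw [RO.frontier_eq_preimage hn h] at hU
    exact hU.of_preimage (nsmul_surjective hn)
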